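/- **Setting.** Complexes in $\mathbb R^n$ are treated combinatorially: a complex $K$ is a set of cells, each given by its dimension and its set of vertices (points of $\mathbb R^n$). A cell $\mu$ is a face of $\sigma$ if its vertices form a proper subset of those of $\sigma$ and $\dim\mu\le\dim\sigma$. (Quadrilateral faces may be skew.) $K$ is complete if all its maximal cells have dimension $n$. A structuring element is a map $b:D_b\to\mathbb Z$ with $0\in D_b\subseteq\mathbb Z^n$. An *ExtendedCubeMap (ECM) representation* of a complete complex $K$ is a triple $(h,g,\mathcal B)$ such that * $h:D\to K$ is a bijection for some $D\subseteq\mathbb Z^n$; write $p_\sigma=h^{-1}(\sigma)$; * $g:\mathbb Z^n\to\{-1,0,\dots,n\}$ satisfies $g(p)=\dim h(p)$ for $p\in D$ and $g(p)=-1$ for $p\notin D$; * $\mathcal B$ is a set of structuring elements such that for each $i$-cell $\sigma\in K$ there is exactly one $b\in\mathcal B$ with: (i) $b(x)=g(x+p_\sigma)$ for all $x\in D_b$; (ii) $b(x)\in\{i-1,-1\}$ for $0\ne x\in D_b$; (iii) for $p\in\mathbb Z^n$: $p-p_\sigma\in D_b$ and $b(p-p_\sigma)=i-1$ if and only if $p=p_\mu$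 for an $(i-1)$-dimensional face $\mu$ of $\sigma$. Let $I=(\mathbb Z^3,B)$ be a binary image with foreground $B\subseteq\mathbb Z^3$, and $Q=Q(I)$ the complex of all faces of the closed unit cubes centred at the points of $B$. The cell $\sigma\in Q$ with barycentre $r_\sigma$ is represented by $p=4r_\sigma$; so $h_Q(4r_\sigma)=\sigma$, $g_Q(4r_\sigma)=\dim\sigma$, and $g_Q=-1$ elsewhere. The boundary complex $\partial Q$ consists of the cells that are faces of exactly one maximal cell, and their faces. A vertex $v$ of $\partial Q$ is *critical* if some edge of $\partial Q$ at $v$ does not lie in exactly two $2$-cells of $\partial Q$, or the link of $v$ in $\partial Q$ does not have exactly one connected component. Let $N_6^1,N_{12}^1,N_8^1$ be the sets of $x\in\{-1,0,1\}^3$ with $1,2,3$ nonzero entries, $N^1$ their union, and $N(p)=N+p$. **Procedure 1 (the image $g_P$).** Start with $g_P=g_Q$. For each $p$ representing a critical vertex $v$: * set $g_P(p)=3$, and $g_P=2,1,0$ on $N^1_6(p),N^1_{12}(p),N^1_8(p)$; * for each $q$ representing an edge at $v$, with other endpoint represented by $q_1$: set $g_P(q)=3$, and $g_P=2$, $g_P=1$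 on $N^1_6(q)$, $N^1_{12}(q)$ respectively, each minus $N^1(p)\cup N^1(q_1)$; * for each $q$ representing a square at $v$, with edges represented by $q_1,\dots,q_4$: set $g_P(q)=3$, and $g_P=2$ on $N_6^1(q)\setminus\bigcup_jN^1(q_j)$. Let $D_P=\{p: g_P(p)\ne-1\}$. **Procedure 2 (the complex $P(I)$ and $h_P$).** Let $c(m)$ be the axis-parallel cube with centre $m$ and edge length $\frac12$. $P(I)$ consists of the following cells. * The cells of $Q$ with no critical vertex. * For each critical $v$: $c(v)$ and all its faces. * For each edge $vw$ of $Q$ with $v$ critical: if $w$ is not critical, the pyramid with apex $w$ over the face of $c(v)$ met by the edge, with its triangles and its edges through $w$; if $w$ is critical, $c(\frac{v+w}2)$ with its faces parallel to $vw$. * For each square $s$ of $Q$ with a critical vertex: for each of the two sides of $s$, the quadrilateral whose vertices are the non-critical vertices of $s$ and, for each critical vertex $v$ of $s$, the vertex of $c(v)$ on that side of $s$ that projects into $s$; and the polyhedron whose vertices are all vertices of the two quadrilaterals. * For each unit cube of $Q$ with a critical vertex: the hexahedron obtained by replacing each critical vertex $v$ of the cube by the vertex of $c(v)$ inside the cube.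 The correspondence $h_P$ agrees with $h_Q$ on the kept cells. A face $\sigma$ of a cube $c(\cdot)$ is represented by $4r_\sigma$. Let $q=4r$, with $r$ the barycentre of an edge, square or unit cube of $Q$ with a critical vertex. The polyhedron replacing that cell is represented by $q$. The quadrilateral on the side of the unit normal $n$ of a square is represented by $q+n$. For the pyramid replacing an edge of direction $d$, the triangle over the base edge with outward direction $a$ (a unit vector $\perp d$) is represented by $q+a$, and the edge through the apex and the base vertex with outward directions $a,a'$ by $q+a+a'$. **The set $B_P$.** It is the following fixed finite set, independent of $I$. Take the structuring elements with value $i$ at $0$, $i-1$ on $F$ and $-1$ on $E$, for the $(i,F,E)$ below, and all their images under the rotations of $\mathbb Z^3$ by multiples of $90^\circ$ about the axes. Here $x,y,z$ is the standard basis. * $i=0$: $F=E=\emptyset$. * $i=1$: $F=\{\pm2x\},E=\{\pm x\}$; $F=\{\pm x\},E=\emptyset$; $F=\{-x,2x-y-z\},E=\{x\}$. * $i=2$: $F=\{\pm2x,\pm2y\},E=\{\pm x,\pm y\}$; $F=\{\pm x,\pm y\},E=\emptyset$; $F=\{-x,\pm y\},E=\{x\}$; $F=\{-x,-y,2x-z,2y-z\},E=\{x,y\}$;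 $F=\{-x,\pm y,2x-z\},E=\{x\}$. * $i=3$: $F=\{\pm2x,\pm2y,\pm2z\},E=\{\pm x,\pm y,\pm z\}$; and, with $U=\{\pm x,\pm y,\pm z\}$: $F=U\setminus E$ for $E=\emptyset,\{x\},\{x,y\}$; $F=(U\setminus E)\cup2E$ for $E=\{x\},\{x,y\},\{x,y,z\}$. **Theorem.** For every binary image $I=(\mathbb Z^3,B)$, the triple $E_P=(h_P,g_P,B_P)$, with $h_P:D_P\to P(I)$, is an ECM representation of the complete complex $P(I)$. -/

import Mathlib

/-! Cells, complexes, boundary, links and critical vertices. -/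

namespace ECM

/-- A cell of a complex in `ℝⁿ`, recorded by its dimension and by the set of its vertices
(its `0`-faces, with their positions in `ℝⁿ`). Polygons and polyhedra whose faces are skew
quadrilaterals are allowed, so a cell need not be the convex hull of its vertices. -/
structure Cell (n : ℕ) where
  dim : ℕ
  verts : Set (Fin n → ℝ)

/-- `μ` is a (proper) face of `σ`. -/
def IsFace {n : ℕ} (μ σ : Cell n) : Prop :=
  μ.verts ⊂ σ.verts ∧ μ.dim ≤ σ.dim

/-- A complex in `ℝⁿ`, as a set of cells together with the relation `IsFace` between them. -/
abbrev Complex (n : ℕ) := Set (Cell n)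

def IsMaximalCell {n : ℕ} (K : Complex n) (μ : Cell n) : Prop :=
  μ ∈ K ∧ ∀ σ ∈ K, ¬ IsFace μ σ

/-- All maximal cells have dimension `n`. -/
def IsComplete {n : ℕ} (K : Complex n) : Prop :=
  ∀ μ, IsMaximalCell K μ → μ.dim = n

/-- A free cell: a face of exactly one maximal cell. -/
def IsFree {n : ℕ} (K : Complex n) (μ : Cell n) : Prop :=
  μ ∈ K ∧ ∃! σ, IsMaximalCell K σ ∧ IsFace μ σ

/-- The smallest subcomplex of `K` containing the cells of `S`. -/
def closureIn {n : ℕ} (K S : Complex n) : Complex n :=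
  {μ ∈ K | ∃ σ ∈ S, μ = σ ∨ IsFace μ σ}

/-- The star of `S` in `K` (it contains the cells of `S` themselves). -/
def starIn {n : ℕ} (K S : Complex n) : Complex n :=
  {σ ∈ K | ∃ μ ∈ S, μ = σ ∨ IsFace μ σ}

/-- The link of `S` in `K`: the closure of the star of `S` minus the star of `S` and of
all faces of `S`. -/
def linkIn {n : ℕ} (K S : Complex n) : Complex n :=
  closureIn K (starIn K S) \ starIn K (closureIn K S)

/-- The boundary subcomplex: the free cells together with all their faces. -/
def boundaryComplex {n : ℕ} (K : Complex n) : Complex n :=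
  closureIn K {μ | IsFree K μ}

/-- `L` has exactly one connected component. -/
def HasOneComponent {n : ℕ} (L : Complex n) : Prop :=
  L.Nonempty ∧ ∀ σ ∈ L, ∀ τ ∈ L,
    Relation.EqvGen (fun a b => a ∈ L ∧ b ∈ L ∧ IsFace a b) σ τ

/-- Condition (E1) at an edge `e`: it has exactly two `2`-cofaces in `∂K`. -/
def CondE1 {n : ℕ} (K : Complex n) (e : Cell n) : Prop :=
  {σ ∈ boundaryComplex K | σ.dim = 2 ∧ IsFace e σ}.ncard = 2

/-- Condition (E2) at a vertex `v`: its link in `∂K` has exactly one component. -/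
def CondE2 {n : ℕ} (K : Complex n) (v : Cell n) : Prop :=
  HasOneComponent (linkIn (boundaryComplex K) {v})

/-- Critical vertices of `K`. -/
def IsCriticalVertex {n : ℕ} (K : Complex n) (v : Cell n) : Prop :=
  v ∈ boundaryComplex K ∧ v.dim = 0 ∧
    ((∃ e ∈ boundaryComplex K, e.dim = 1 ∧ IsFace v e ∧ ¬ CondE1 K e) ∨ ¬ CondE2 K v)

/-! Structuring elements and ExtendedCubeMap representations. -/

/-- A structuring element: a map from a domain in `ℤⁿ` containing the origin to `ℤ`,
written as a partial function (`none` means outside of the domain). -/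
structure StructuringElement (n : ℕ) where
  toFun : (Fin n → ℤ) → Option ℤ
  zero_mem : toFun 0 ≠ none

/-- The conditions relating a structuring element `b` to the cell `h p`. -/
structure Detects {n : ℕ} (D : Set (Fin n → ℤ)) (h : (Fin n → ℤ) → Cell n)
    (g : (Fin n → ℤ) → ℤ) (p : Fin n → ℤ) (b : StructuringElement n) : Prop where
  /-- `b` fits around `p` -/
  fits : ∀ x k, b.toFun x = some k → k = g (x + p)
  values : ∀ x k, x ≠ 0 → b.toFun x = some k → k = ((h p).dim : ℤ) - 1 ∨ k = -1
  /-- `b` detects exactly the codimension-one faces -/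
  faces : ∀ x, b.toFun (x - p) = some (((h p).dim : ℤ) - 1) ↔
    x ∈ D ∧ (h x).dim + 1 = (h p).dim ∧ IsFace (h x) (h p)

/-- `(h, g, B)` is an ExtendedCubeMap representation of the complete complex `K`,
where `D` is the domain of `h`. -/
structure IsECMRepresentation {n : ℕ} (K : Complex n) (D : Set (Fin n → ℤ))
    (h : (Fin n → ℤ) → Cell n) (g : (Fin n → ℤ) → ℤ)
    (B : Set (StructuringElement n)) : Prop where
  complete : IsComplete K
  bijective : Set.BijOn h D K
  color_range : ∀ p, -1 ≤ g p ∧ g p ≤ n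
  color_mem : ∀ p ∈ D, g p = (h p).dim
  color_notMem : ∀ p ∉ D, g p = -1
  structuring : ∀ p ∈ D, ∃! b, b ∈ B ∧ Detects D h g p b

/-! The cubical complex of an image and its representation `(h_Q, g_Q)`. -/

/-- Points of `ℤ³`. A point `z` also stands for the point `z / 4` of `ℝ³`. -/
abbrev Z3 := Fin 3 → ℤ

noncomputable def quarter (z : Z3) : Fin 3 → ℝ := fun j => (z j : ℝ) / 4

noncomputable def cellOf (d : ℕ) (S : Set Z3) : Cell 3 := ⟨d, quarter '' S⟩

def IsCorner (e : Z3) : Prop := ∀ j, e j = 1 ∨ e j = -1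

def IsSign (s : Z3) : Prop := ∀ j, s j = 0 ∨ s j = 1 ∨ s j = -1

/-- The face in direction `s` of the axis-parallel cube with centre `m / 4` and edge length
`a / 2`: the `i`-faces belong to the `s` with `i` zero entries, and `s = 0` gives the cube.
Four times the barycentre of the face is `m + a • s`. -/
noncomputable def boxFace (m : Z3) (a : ℤ) (s : Z3) : Cell 3 :=
  cellOf (Finset.univ.filter (fun j => s j = 0)).card
    {x | ∃ e, IsCorner e ∧ (∀ j, s j ≠ 0 → e j = s j) ∧ x = m + a • e}

/-- `Q(I)` for the image with foreground `B`: all faces of the unit cubes centred at the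
points of `B`. -/
def cubicalComplex (B : Set Z3) : Complex 3 :=
  {σ | ∃ c ∈ B, ∃ s, IsSign s ∧ σ = boxFace ((4 : ℤ) • c) 2 s}

/-- `D_Q`: the points `4 r` where `r` is the barycentre of a cell of `Q(I)`. -/
def domQ (B : Set Z3) : Set Z3 :=
  {p | ∃ c ∈ B, ∃ s, IsSign s ∧ p = (4 : ℤ) • c + (2 : ℤ) • s}

/-- `h_Q`: the cell with barycentre `p / 4`. -/
noncomputable def hQ (p : Z3) : Cell 3 :=
  cellOf (Finset.univ.filter (fun j => (4 : ℤ) ∣ p j)).card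
    {x | ∀ j, if (4 : ℤ) ∣ p j then x j = p j + 2 ∨ x j = p j - 2 else x j = p j}

theorem hQ_eq (c s : Z3) (hs : IsSign s) :
    hQ ((4 : ℤ) • c + (2 : ℤ) • s) = boxFace ((4 : ℤ) • c) 2 s := by
  have key : ∀ j, (4 : ℤ) ∣ ((4 : ℤ) • c + (2 : ℤ) • s) j ↔ s j = 0 := by
    intro j
    have := hs j
    simp only [Pi.add_apply, Pi.smul_apply, smul_eq_mul]
    omega
  unfold hQ boxFace
  simp only [key]
  congr 1
  ext x
  constructor
  · intro hx
    refine ⟨fun j => if s j = 0 then (x j - 4 * c j) / 2 else s j, ?_, ?_, ?_⟩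
    · intro j
      have h1 := hx j
      have h2 := hs j
      simp only [Pi.add_apply, Pi.smul_apply, smul_eq_mul] at h1
      by_cases h : s j = 0
      · simp only [h, if_true] at h1 ⊢
        omega
      · simp only [h, if_false]
        omega
    · intro j h
      simp [h]
    · funext j
      have h1 := hx j
      simp only [Pi.add_apply, Pi.smul_apply, smul_eq_mul] at h1 ⊢
      by_cases h : s j = 0
      · simp only [h, if_true] at h1 ⊢
        omega
      · simp only [h, if_false] at h1 ⊢
        omega
  · rintro ⟨e, he, hes, rfl⟩ j
    have h1 := he j
    have h2 := hes j
    simp only [Pi.add_apply, Pi.smul_apply, smul_eq_mul]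
    by_cases h : s j = 0
    · simp only [h, if_true]
      omega
    · simp only [h, if_false]
      rw [h2 h]

open Classical in
/-- `g_Q` -/
noncomputable def gQ (B : Set Z3) (p : Z3) : ℤ :=
  if p ∈ domQ B then ((hQ p).dim : ℤ) else -1

/-- The points representing the `i`-faces of the cell represented by `q`. -/
def faceReps (B : Set Z3) (q : Z3) (i : ℤ) : Set Z3 :=
  {x | x ∈ domQ B ∧ gQ B x = i ∧ IsFace (hQ x) (hQ q)}

/-! The repairing procedure on colors, with output `g_P`. -/

/-- `N₆^l`, `N₁₂^l`, `N₈^l`, and `N^l`. -/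
def N6 (l : ℤ) : Set Z3 := {x | ∃ i, |x i| = l ∧ ∀ j, j ≠ i → x j = 0}

def N12 (l : ℤ) : Set Z3 := {x | ∃ i, x i = 0 ∧ ∀ j, j ≠ i → |x j| = l}

def N8 (l : ℤ) : Set Z3 := {x | ∀ i, |x i| = l}

def NBox (l : ℤ) : Set Z3 := {x | ∃ i, |x i| = l ∧ ∀ j, j ≠ i → |x j| ≤ l}

/-- `N(p)` -/
def around (N : Set Z3) (p : Z3) : Set Z3 := {x | ∃ q ∈ N, x = q + p}

/-- `R`: the points representing critical vertices of `Q(I)`. -/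
def criticalReps (B : Set Z3) : Set Z3 :=
  {p | p ∈ domQ B ∧ gQ B p = 0 ∧ IsCriticalVertex (cubicalComplex B) (hQ p)}

/-- `ST_p`: the points representing the cells in the star of `h_Q(p)`. -/
def starReps (B : Set Z3) (p : Z3) : Set Z3 :=
  {q | q ∈ domQ B ∧ hQ q ∈ starIn (cubicalComplex B) {hQ p}}

/-- `q` represents an edge of `Q(I)` with endpoints represented by the distinct points
`p` and `p₁`, where `p` represents a critical vertex. -/
def IsCriticalEdge (B : Set Z3) (p q p₁ : Z3) : Prop :=
  p ∈ criticalReps B ∧ q ∈ starReps B p ∧ gQ B q = 1 ∧ p₁ ∈ faceReps B q 0 ∧ p₁ ≠ p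

/-- The color changes `g_P(x) = k`. -/
inductive Recolored (B : Set Z3) : Z3 → ℤ → Prop
  | vertex (p : Z3) (hp : p ∈ criticalReps B) : Recolored B p 3
  | vertex2 (p : Z3) (hp : p ∈ criticalReps B) (x : Z3) (hx : x ∈ around (N6 1) p) :
      Recolored B x 2
  | vertex1 (p : Z3) (hp : p ∈ criticalReps B) (x : Z3) (hx : x ∈ around (N12 1) p) :
      Recolored B x 1
  | vertex0 (p : Z3) (hp : p ∈ criticalReps B) (x : Z3) (hx : x ∈ around (N8 1) p) :
      Recolored B x 0
  | edge (p q p₁ : Z3) (hq : IsCriticalEdge B p q p₁) : Recolored B q 3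
  | edge2 (p q p₁ : Z3) (hq : IsCriticalEdge B p q p₁) (x : Z3)
      (hx : x ∈ around (N6 1) q \ (around (NBox 1) p ∪ around (NBox 1) p₁)) :
      Recolored B x 2
  | edge1 (p q p₁ : Z3) (hq : IsCriticalEdge B p q p₁) (x : Z3)
      (hx : x ∈ around (N12 1) q \ (around (NBox 1) p ∪ around (NBox 1) p₁)) :
      Recolored B x 1
  | square (p : Z3) (hp : p ∈ criticalReps B) (q : Z3) (hq : q ∈ starReps B p)
      (hd : gQ B q = 2) : Recolored B q 3
  | square2 (p : Z3) (hp : p ∈ criticalReps B) (q : Z3) (hq : q ∈ starReps B p)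
      (hd : gQ B q = 2) (x : Z3)
      (hx : x ∈ around (N6 1) q) (hx' : ∀ y ∈ faceReps B q 1, x ∉ around (NBox 1) y) :
      Recolored B x 2

open Classical in
/-- `g_P`: the new color if the color was changed, the color `g_Q` otherwise. -/
noncomputable def gP (B : Set Z3) (p : Z3) : ℤ :=
  if h : ∃ k, Recolored B p k then h.choose else gQ B p

/-- `D_P` -/
def domP (B : Set Z3) : Set Z3 := {p | gP B p ≠ -1}

/-! The polyhedral complex `P(I)` and the correspondence `h_P`. -/

/-- The cone with apex `w / 4` over the cell `τ`. -/
noncomputable def cone (w : Z3) (τ : Cell 3) : Cell 3 := ⟨τ.dim + 1, insert (quarter w) τ.verts⟩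

open Classical in
/-- Here `q` represents a square or a cube of `Q(I)`, and each vertex of that cell (represented
by `q + 2 • e`) is kept if it is not critical. A critical vertex `v` is replaced by a vertex of
the cube `c(v)`: for `n = 0` and a cube, by the vertex of `c(v)` inside that cube; for a unit
vector `n` normal to a square, by the vertex of `c(v)` which lies on the side `n` of the square
and projects into the square. -/
noncomputable def movedVerts (B : Set Z3) (q n : Z3) : Set Z3 :=
  {x | ∃ e : Z3, q + (2 : ℤ) • e ∈ faceReps B q 0 ∧
    x = if q + (2 : ℤ) • e ∈ criticalReps B then q + e + n else q + (2 : ℤ) • e}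

/-- `n` is one of the two unit normals of the square represented by `q`. -/
def IsNormal (q n : Z3) : Prop := n ∈ N6 1 ∧ ∀ j, n j ≠ 0 → ¬ (4 : ℤ) ∣ q j

/-- The quadrilateral, on the side `n`, of the polyhedron replacing the square at `q`. -/
noncomputable def quad (B : Set Z3) (q n : Z3) : Cell 3 := cellOf 2 (movedVerts B q n)

/-- The polyhedron replacing the square at `q`. With the critical vertices among the four
vertices `v, v₁, v₂, v₃` of the square in parentheses (`v₃` opposite to `v`) it is
`p₁` (`v`), `p₂` (`v, v₁`), `p₃` (`v, v₃`), `p₄` (`v, v₁, v₂`), or the cube of edge length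
`1 / 2` with the same centre as the square (all four). -/
noncomputable def slab (B : Set Z3) (q n : Z3) : Cell 3 :=
  cellOf 3 (movedVerts B q n ∪ movedVerts B q (-n))

/-- The hexahedron replacing the cube at `q`. -/
noncomputable def hexahedron (B : Set Z3) (q : Z3) : Cell 3 := cellOf 3 (movedVerts B q 0)

/-- The cells of `P(I)`. -/
inductive IsRepairedCell (B : Set Z3) : Cell 3 → Prop
  /-- cells of `Q(I)` outside of the stars of the critical vertices -/
  | kept (σ : Cell 3) (hσ : σ ∈ cubicalComplex B)
      (h : ∀ p ∈ criticalReps B, σ ∉ starIn (cubicalComplex B) {hQ p}) : IsRepairedCell B σ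
  /-- the cube `c(v)` and its faces -/
  | vertexCube (p : Z3) (hp : p ∈ criticalReps B) (s : Z3) (hs : IsSign s) :
      IsRepairedCell B (boxFace p 1 s)
  /-- the pyramid `k(v, w)` with its triangles and its edges through `w`, for `w` not critical:
  the cones over the square face of `c(v)` in direction `d` of `w` and over its faces -/
  | pyramid (p q p₁ : Z3) (hq : IsCriticalEdge B p q p₁) (h₁ : p₁ ∉ criticalReps B)
      (d s : Z3) (hd : q = p + (2 : ℤ) • d) (hs : IsSign s) (hds : ∀ j, d j ≠ 0 → s j = d j) :
      IsRepairedCell B (cone p₁ (boxFace p 1 s))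
  /-- the cube `c((v + w) / 2)` with its faces parallel to the edge, for `w` critical -/
  | edgeCube (p q p₁ : Z3) (hq : IsCriticalEdge B p q p₁) (h₁ : p₁ ∈ criticalReps B)
      (d s : Z3) (hd : q = p + (2 : ℤ) • d) (hs : IsSign s) (hds : ∀ j, d j ≠ 0 → s j = 0) :
      IsRepairedCell B (boxFace q 1 s)
  | square (p : Z3) (hp : p ∈ criticalReps B) (q : Z3) (hq : q ∈ starReps B p)
      (hd : gQ B q = 2) (n : Z3) (hn : IsNormal q n) : IsRepairedCell B (slab B q n)
  | squareFace (p : Z3) (hp : p ∈ criticalReps B) (q : Z3) (hq : q ∈ starReps B p)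
      (hd : gQ B q = 2) (n : Z3) (hn : IsNormal q n) : IsRepairedCell B (quad B q n)
  | cube (p : Z3) (hp : p ∈ criticalReps B) (q : Z3) (hq : q ∈ starReps B p)
      (hd : gQ B q = 3) : IsRepairedCell B (hexahedron B q)

/-- `P(I)` -/
def polyhedralComplex (B : Set Z3) : Complex 3 := {σ | IsRepairedCell B σ}

/-- The graph of `h_P`: `Represents B x σ` says that `x` is the point representing the cell `σ`.
It is the point, among those of color `dim σ`, closest to four times the barycentre of `σ`. -/
inductive Represents (B : Set Z3) : Z3 → Cell 3 → Prop
  | kept (x : Z3) (hx : x ∈ domQ B)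
      (h : ∀ p ∈ criticalReps B, x ∉ starReps B p) : Represents B x (hQ x)
  | vertexCube (p : Z3) (hp : p ∈ criticalReps B) (s : Z3) (hs : IsSign s) :
      Represents B (p + s) (boxFace p 1 s)
  | pyramid (p q p₁ : Z3) (hq : IsCriticalEdge B p q p₁) (h₁ : p₁ ∉ criticalReps B)
      (d s : Z3) (hd : q = p + (2 : ℤ) • d) (hs : IsSign s) (hds : ∀ j, d j ≠ 0 → s j = d j) :
      Represents B (q + (s - d)) (cone p₁ (boxFace p 1 s))
  | edgeCube (p q p₁ : Z3) (hq : IsCriticalEdge B p q p₁) (h₁ : p₁ ∈ criticalReps B)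
      (d s : Z3) (hd : q = p + (2 : ℤ) • d) (hs : IsSign s) (hds : ∀ j, d j ≠ 0 → s j = 0) :
      Represents B (q + s) (boxFace q 1 s)
  | square (p : Z3) (hp : p ∈ criticalReps B) (q : Z3) (hq : q ∈ starReps B p)
      (hd : gQ B q = 2) (n : Z3) (hn : IsNormal q n) : Represents B q (slab B q n)
  | squareFace (p : Z3) (hp : p ∈ criticalReps B) (q : Z3) (hq : q ∈ starReps B p)
      (hd : gQ B q = 2) (n : Z3) (hn : IsNormal q n) : Represents B (q + n) (quad B q n)
  | cube (p : Z3) (hp : p ∈ criticalReps B) (q : Z3) (hq : q ∈ starReps B p)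
      (hd : gQ B q = 3) : Represents B q (hexahedron B q)

open Classical in
/-- `h_P` (with an irrelevant value at points which represent no cell). -/
noncomputable def hP (B : Set Z3) (x : Z3) : Cell 3 :=
  if h : ∃ σ, Represents B x σ then h.choose else ⟨0, ∅⟩

/-! The structuring elements `B_P`. -/

/-- The structuring element with value `i` at the origin, `i - 1` at the points of `F`, and `-1`
at the points of `E`. -/
def element (i : ℤ) (F E : List Z3) : StructuringElement 3 where
  toFun x := if x = 0 then some i else if x ∈ F then some (i - 1)
    else if x ∈ E then some (-1) else none
  zero_mem := by simp

/-- The image of a structuring element under a symmetry of `ℤ³` (a signed permutation of the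
coordinates). -/
def StructuringElement.transform (b : StructuringElement 3) (π : Equiv.Perm (Fin 3))
    (u : Fin 3 → ℤˣ) : StructuringElement 3 where
  toFun x := b.toFun (fun j => (u j : ℤ) * x (π j))
  zero_mem := by
    have h : (fun j => (u j : ℤ) * (0 : Z3) (π j)) = 0 := by
      funext j
      simp
    rw [h]
    exact b.zero_mem

/-- The structuring elements up to symmetry. -/
def baseElements : List (StructuringElement 3) := [
  -- vertices
  element 0 [] [],
  -- edges: unit edges, edges of length `1 / 2`, edges from a vertex of `c(v)` to `w`
  element 1 [![2, 0, 0], ![-2, 0, 0]] [![1, 0, 0], ![-1, 0, 0]],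
  element 1 [![1, 0, 0], ![-1, 0, 0]] [],
  element 1 [![-1, 0, 0], ![2, -1, -1]] [![1, 0, 0]],
  -- polygons: unit squares
  element 2 [![2, 0, 0], ![-2, 0, 0], ![0, 2, 0], ![0, -2, 0]]
    [![1, 0, 0], ![-1, 0, 0], ![0, 1, 0], ![0, -1, 0]],
  -- squares of edge length `1 / 2` and quadrilaterals without a unit edge
  element 2 [![1, 0, 0], ![-1, 0, 0], ![0, 1, 0], ![0, -1, 0]] [],
  -- triangles
  element 2 [![-1, 0, 0], ![0, 1, 0], ![0, -1, 0]] [![1, 0, 0]],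
  -- quadrilaterals with two and with one unit edges
  element 2 [![-1, 0, 0], ![0, -1, 0], ![2, 0, -1], ![0, 2, -1]] [![1, 0, 0], ![0, 1, 0]],
  element 2 [![-1, 0, 0], ![0, 1, 0], ![0, -1, 0], ![2, 0, -1]] [![1, 0, 0]],
  -- polyhedra: unit cubes
  element 3 [![2, 0, 0], ![-2, 0, 0], ![0, 2, 0], ![0, -2, 0], ![0, 0, 2], ![0, 0, -2]]
    [![1, 0, 0], ![-1, 0, 0], ![0, 1, 0], ![0, -1, 0], ![0, 0, 1], ![0, 0, -1]],
  -- cubes of edge length `1 / 2`, `p₃`, `p₄`, hexahedra without a unit square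
  element 3 [![1, 0, 0], ![-1, 0, 0], ![0, 1, 0], ![0, -1, 0], ![0, 0, 1], ![0, 0, -1]] [],
  -- pyramids and `p₂`
  element 3 [![-1, 0, 0], ![0, 1, 0], ![0, -1, 0], ![0, 0, 1], ![0, 0, -1]] [![1, 0, 0]],
  -- `p₁`
  element 3 [![-1, 0, 0], ![0, -1, 0], ![0, 0, 1], ![0, 0, -1]] [![1, 0, 0], ![0, 1, 0]],
  -- hexahedra with one, two and three unit squares
  element 3 [![2, 0, 0], ![-1, 0, 0], ![0, 1, 0], ![0, -1, 0], ![0, 0, 1], ![0, 0, -1]]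
    [![1, 0, 0]],
  element 3 [![2, 0, 0], ![-1, 0, 0], ![0, 2, 0], ![0, -1, 0], ![0, 0, 1], ![0, 0, -1]]
    [![1, 0, 0], ![0, 1, 0]],
  element 3 [![2, 0, 0], ![-1, 0, 0], ![0, 2, 0], ![0, -1, 0], ![0, 0, 2], ![0, 0, -1]]
    [![1, 0, 0], ![0, 1, 0], ![0, 0, 1]]]

/-- `B_P`: it does not depend on the image. Since every base element has a mirror symmetry,
the signed permutations give the same set as the rotations by multiples of `90` degrees. -/
def structuringElementsP : Set (StructuringElement 3) :=
  {b | ∃ b₀ ∈ baseElements, ∃ π u, b = b₀.transform π u}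

end ECM

/-! Criticality matters only through the fact that critical vertices are vertices of `Q`; the repair
can be analysed for an arbitrary set `R` of points to be repaired. All cells then have one
coordinate description, `repairedCell R p`. Rounding the odd coordinates of `p` to `2 + 4ℤ` gives
`base p`, which names the grid cell of origin, and `p - base p` tells on which side of its
thickening the cell lies. The vertices of the cell are the vertices of the grid cell outside `R`,
together with the odd points within maximum distance one of `p` that round into `R`. Its dimension
counts the even coordinates of `p` if the grid cell has a vertex in `R` (it is touched), and the
multiples of four otherwise.

Inclusion of vertex sets decouples into conditions on single coordinates
(`touchedFaceCoord_of_subset`, `gridFaceCoord_of_subset` and their converses). Hence distinct points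
give distinct vertex sets (`cellVerts_injective`), and counting dimensions lists the codimension-one
faces. At a touched `p` they are the touched points one step away along an even axis and, if no
coordinate of `p` is `2` modulo `4`, the kept cells two steps away along an axis where `p` is a
multiple of four, the other coordinates being rounded (`facet_iff_of_touched`).

For existence of a structuring element, the pattern around a touched `p` depends only on the signs
`p - base p`, on the directions in which the unit neighbour is untouched, at most one per axis
(`touched_update`), and on the condition allowing kept facets. Sorting the axes by type and
reflecting them brings this pattern into the fixed list (`repairElement_mem_structuringElementsP`);
untouched cells are handled by `gridElement`.

For uniqueness, detection prescribes the value at the origin and the set where the value is `i - 1`.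
In every element of `B_P` the remaining domain, with value `-1`, is recovered from that set by a
rule invariant under signed permutations (`Gap`), so the element is determined
(`existsUnique_of_detects`). This gives `isECMRepresentation_repaired` for every `R`.

It remains to take for `R` the critical vertices and compare with the procedures. Both `gP` and `hP`
choose a value from a relation, so `Recolored.spec` and `Represents.spec` show that every admissible
choice agrees with the coordinate formula; `gP_eq`, `hP_eq` and `polyhedralComplex_eq` follow. -/

namespace ECM

/-! ### Uniform coordinates for kept and repaired cells -/

/-- The coordinate of the nearest point of `2ℤ`, chosen in `2 + 4ℤ` for odd `a`. -/
def baseCoord (a : ℤ) : ℤ := if a % 4 = 1 then a + 1 else if a % 4 = 3 then a - 1 else a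

/-- The point representing the cell of the cubical complex from which the cell represented by
`p` originates. -/
def base (p : Z3) : Z3 := fun j => baseCoord (p j)

/-- The coordinate condition in `IsVertexOf`. -/
def VertexCoord (a b : ℤ) : Prop :=
  a % 4 = 2 ∧ b - 2 ≤ a ∧ a ≤ b + 2 ∧ (b % 4 ≠ 0 → b - 1 ≤ a ∧ a ≤ b + 1)

/-- `w` represents a vertex of the cell of the cubical grid represented by `base p`. -/
def IsVertexOf (w p : Z3) : Prop := ∀ j, VertexCoord (w j) (p j)

/-- The cell of the cubical grid represented by `base p` has a vertex in `R`. -/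
def Touched (R : Set Z3) (p : Z3) : Prop := ∃ v ∈ R, IsVertexOf v p

/-- The vertices of the cell represented by `p` when the vertices in `R` are repaired. -/
def cellVerts (R : Set Z3) (p : Z3) : Set Z3 :=
  {w | (w ∉ R ∧ IsVertexOf w p) ∨
    ((∀ j, w j % 2 = 1 ∧ p j - 1 ≤ w j ∧ w j ≤ p j + 1) ∧ base w ∈ R)}

open Classical in
/-- The dimension of the cell represented by `p` when the vertices in `R` are repaired. -/
noncomputable def cellDim (R : Set Z3) (p : Z3) : ℕ :=
  if Touched R p then (Finset.univ.filter (fun j => (2 : ℤ) ∣ p j)).card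
  else (Finset.univ.filter (fun j => (4 : ℤ) ∣ p j)).card

/-- The cell represented by `p` when the vertices in `R` are repaired. -/
noncomputable def repairedCell (R : Set Z3) (p : Z3) : Cell 3 :=
  cellOf (cellDim R p) (cellVerts R p)

theorem quarter_injective : Function.Injective quarter := by
  intro x y h
  funext j
  have := congrFun h j
  simp only [quarter] at this
  rw [div_left_inj' four_ne_zero] at this
  exact_mod_cast this

theorem isFace_cellOf {a b : ℕ} {S T : Set Z3} :
    IsFace (cellOf a S) (cellOf b T) ↔ S ⊂ T ∧ a ≤ b := by
  simp only [IsFace, cellOf, ssubset_iff_subset_ne, Set.image_subset_image_iff quarter_injective,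
    Ne, quarter_injective.image_injective.eq_iff]

theorem cellOf_inj {a b : ℕ} {S T : Set Z3} : cellOf a S = cellOf b T ↔ a = b ∧ S = T := by
  simp only [cellOf, Cell.mk.injEq, quarter_injective.image_injective.eq_iff]

theorem baseCoord_spec (a : ℤ) :
    (a % 4 = 1 → baseCoord a = a + 1) ∧ (a % 4 = 3 → baseCoord a = a - 1) ∧
      (a % 4 = 0 → baseCoord a = a) ∧ (a % 4 = 2 → baseCoord a = a) := by
  unfold baseCoord
  split_ifs <;> omega

theorem vertexCoord_baseCoord {a b : ℤ} : VertexCoord a (baseCoord b) ↔ VertexCoord a b := by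
  have := baseCoord_spec b
  unfold VertexCoord
  omega

theorem isVertexOf_base {w p : Z3} : IsVertexOf w (base p) ↔ IsVertexOf w p :=
  forall_congr' fun _ => vertexCoord_baseCoord

theorem touched_base {R : Set Z3} {p : Z3} : Touched R (base p) ↔ Touched R p := by
  simp only [Touched, isVertexOf_base]

theorem base_of_even {p : Z3} (h : ∀ j, 2 ∣ p j) : base p = p := by
  funext j
  have := baseCoord_spec (p j)
  have := h j
  simp only [base]
  omega

/-! ### The face relation, coordinate by coordinate -/

/-- The coordinate condition for a repaired cell to be a face of a repaired cell. -/
def TouchedFaceCoord (a b : ℤ) : Prop := a = b ∨ (b % 2 = 0 ∧ (a = b + 1 ∨ a = b - 1))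

/-- The coordinate condition for a cell of the cubical grid to be a face of a cell. -/
def GridFaceCoord (a b : ℤ) : Prop := a = baseCoord b ∨ (b % 4 = 0 ∧ (a = b + 2 ∨ a = b - 2))

/-- The corner over `v` of the repaired cell at `x`, on the side `σ`. -/
def cornerOver (x v : Z3) (σ : ℤ) : Z3 := fun j =>
  if x j % 2 = 1 then x j else if x j % 4 = 2 then x j + σ else (x j + v j) / 2

theorem cornerOver_spec {x v : Z3} {σ : ℤ} (j : Fin 3) :
    (x j % 2 = 1 → cornerOver x v σ j = x j) ∧ (x j % 4 = 2 → cornerOver x v σ j = x j + σ) ∧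
      (x j % 4 = 0 → cornerOver x v σ j = (x j + v j) / 2) := by
  unfold cornerOver
  split_ifs <;> omega

/-- Every coordinate of the corner is odd and adjacent to that of `v`: a step `σ` off a normal
coordinate, or the midpoint between a multiple of four and `v`. Rounding undoes either displacement.
-/
theorem base_cornerOver {x v : Z3} {σ : ℤ} (hv : IsVertexOf v x) (hσ : σ = 1 ∨ σ = -1) :
    base (cornerOver x v σ) = v := by
  funext j
  have h1 := hv j
  have h2 := baseCoord_spec (cornerOver x v σ j)
  have h3 := cornerOver_spec (x := x) (v := v) (σ := σ) j
  simp only [base]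
  unfold VertexCoord at h1
  omega

theorem cornerOver_mem {R : Set Z3} {x v : Z3} {σ : ℤ} (hv : v ∈ R) (hx : IsVertexOf v x)
    (hσ : σ = 1 ∨ σ = -1) : cornerOver x v σ ∈ cellVerts R x := by
  refine Or.inr ⟨fun j => ?_, by rwa [base_cornerOver hx hσ]⟩
  have h1 := hx j
  have h3 := cornerOver_spec (x := x) (v := v) (σ := σ) j
  unfold VertexCoord at h1
  omega

/-- Kept vertices have all coordinates even and new ones have all coordinates odd, so the parity of
one coordinate decides the kind of a vertex. -/
theorem odd_of_mem_cellVerts {R : Set Z3} {p y : Z3} (h : y ∈ cellVerts R p) {i : Fin 3}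
    (hi : y i % 2 = 1) :
    (∀ j, y j % 2 = 1 ∧ p j - 1 ≤ y j ∧ y j ≤ p j + 1) ∧ base y ∈ R := by
  rcases h with h | h
  · have := (h.2 i).1
    omega
  · exact h

theorem even_of_mem_cellVerts {R : Set Z3} {p y : Z3} (h : y ∈ cellVerts R p) {i : Fin 3}
    (hi : y i % 2 = 0) : y ∉ R ∧ IsVertexOf y p := by
  rcases h with h | h
  · exact h
  · have := (h.1 i).1
    omega

theorem cornerOver_odd {x v : Z3} {σ : ℤ} (hx : IsVertexOf v x) (hσ : σ = 1 ∨ σ = -1)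
    (j : Fin 3) : cornerOver x v σ j % 2 = 1 := by
  have h1 := hx j
  have h3 := cornerOver_spec (x := x) (v := v) (σ := σ) j
  unfold VertexCoord at h1
  omega

theorem isVertexOf_of_odd {p y : Z3} (h : ∀ j, y j % 2 = 1 ∧ p j - 1 ≤ y j ∧ y j ≤ p j + 1) :
    IsVertexOf (base y) p := by
  intro j
  have h1 := h j
  have h2 := baseCoord_spec (y j)
  simp only [base]
  unfold VertexCoord
  omega

/-- Corners of `x` over a vertex in `R` must lie within distance one of `p`. Along a normal axis the
two choices of `σ` already pin down `p j`; along an odd axis `p j` may also be an even neighbour. An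
axis where `x j` is a multiple of four needs a vertex on the opposite side. -/
theorem touchedFaceCoord_of_subset {R : Set Z3} {x p : Z3} (hx : Touched R x)
    (h : cellVerts R x ⊆ cellVerts R p) (j : Fin 3) : TouchedFaceCoord (x j) (p j) := by
  obtain ⟨v, hv, hvx⟩ := hx
  have key : ∀ v ∈ R, IsVertexOf v x → ∀ σ : ℤ, (σ = 1 ∨ σ = -1) →
      p j - 1 ≤ cornerOver x v σ j ∧ cornerOver x v σ j ≤ p j + 1 := fun v hv hvx σ hσ =>
    ((odd_of_mem_cellVerts (h (cornerOver_mem hv hvx hσ)) (cornerOver_odd hvx hσ j)).1 j).2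
  have h1 := key v hv hvx 1 (Or.inl rfl)
  have h2 := key v hv hvx (-1) (Or.inr rfl)
  have h3 := cornerOver_spec (x := x) (v := v) (σ := 1) j
  have h4 := cornerOver_spec (x := x) (v := v) (σ := -1) j
  have hvj := hvx j
  unfold VertexCoord at hvj
  unfold TouchedFaceCoord
  by_cases h0 : x j % 4 = 0
  -- The reflection of `v` in the `j`-th coordinate is again a vertex of the grid cell. Whether it
  -- is repaired or kept, it supplies a vertex of `x` on the other side, which forces `x j = p j`.
  · set v' : Z3 := Function.update v j (2 * x j - v j) with hv'
    have hv'j : v' j = 2 * x j - v j := by simp [hv']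
    have hv'x : IsVertexOf v' x := by
      intro i
      by_cases hij : i = j
      · subst hij
        rw [hv'j]
        unfold VertexCoord
        omega
      · rw [hv', Function.update_of_ne hij]
        exact hvx i
    by_cases hR : v' ∈ R
    · have h5 := key v' hR hv'x 1 (Or.inl rfl)
      have h6 := cornerOver_spec (x := x) (v := v') (σ := 1) j
      omega
    · have h7 := (even_of_mem_cellVerts (h (Or.inl ⟨hR, hv'x⟩)) (i := j) (by omega)).2 j
      unfold VertexCoord at h7
      omega
  · omega

/-- The vertex of the grid cell at `x` on the side `σ`. -/
def gridVertex (x : Z3) (σ : ℤ) : Z3 := fun j => if x j % 4 = 0 then x j + 2 * σ else x j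

theorem isVertexOf_gridVertex {x : Z3} (hx : ∀ j, 2 ∣ x j) {σ : ℤ} (hσ : σ = 1 ∨ σ = -1) :
    IsVertexOf (gridVertex x σ) x := by
  intro j
  have := hx j
  unfold VertexCoord gridVertex
  split_ifs <;> omega

/-- Two diagonally opposite vertices of the grid cell suffice: between them they attain both
extremes of every coordinate. -/
theorem gridFaceCoord_of_forall {x p : Z3} (hx : ∀ j, 2 ∣ x j)
    (h : ∀ w, IsVertexOf w x → IsVertexOf w p) (j : Fin 3) : GridFaceCoord (x j) (p j) := by
  have h1 := h _ (isVertexOf_gridVertex hx (Or.inl rfl)) j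
  have h2 := h _ (isVertexOf_gridVertex hx (Or.inr rfl)) j
  have := hx j
  have := baseCoord_spec (p j)
  unfold VertexCoord gridVertex at h1 h2
  unfold GridFaceCoord
  split_ifs at h1 h2 <;> omega

theorem IsVertexOf.of_gridFaceCoord {x p w : Z3} (h : ∀ j, GridFaceCoord (x j) (p j))
    (hw : IsVertexOf w x) : IsVertexOf w p := by
  intro j
  have h1 := h j
  have h2 := hw j
  have := baseCoord_spec (p j)
  unfold GridFaceCoord at h1
  unfold VertexCoord at h2 ⊢
  omega

theorem not_touched_of_gridFaceCoord {R : Set Z3} {x p : Z3}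
    (h : ∀ j, GridFaceCoord (x j) (p j)) (hp : ¬ Touched R p) : ¬ Touched R x :=
  fun ⟨v, hv, hvx⟩ => hp ⟨v, hv, hvx.of_gridFaceCoord h⟩

/-- An odd vertex would round to a vertex of the grid cell lying in `R`, which is excluded. -/
theorem cellVerts_of_not_touched {R : Set Z3} {p : Z3} (hp : ¬ Touched R p) :
    cellVerts R p = {w | IsVertexOf w p} := by
  ext w
  constructor
  · rintro (h | h)
    · exact h.2
    · exact absurd ⟨_, h.2, isVertexOf_of_odd h.1⟩ hp
  · exact fun h => Or.inl ⟨fun hw => hp ⟨w, hw, h⟩, h⟩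

theorem gridFaceCoord_of_subset {R : Set Z3} {x p : Z3} (hx : ¬ Touched R x)
    (hx2 : ∀ j, 2 ∣ x j) (h : cellVerts R x ⊆ cellVerts R p) (j : Fin 3) :
    GridFaceCoord (x j) (p j) := by
  refine gridFaceCoord_of_forall hx2 (fun w hw => ?_) j
  have h1 : w ∈ cellVerts R x := by
    rw [cellVerts_of_not_touched hx]
    exact hw
  have := (hw 0).1
  exact (even_of_mem_cellVerts (h h1) (i := 0) (by omega)).2

theorem subset_of_gridFaceCoord {R : Set Z3} {x p : Z3} (hx : ¬ Touched R x)
    (h : ∀ j, GridFaceCoord (x j) (p j)) : cellVerts R x ⊆ cellVerts R p := by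
  rw [cellVerts_of_not_touched hx]
  exact fun w hw => Or.inl ⟨fun hR => hx ⟨w, hR, hw⟩, IsVertexOf.of_gridFaceCoord h hw⟩

theorem subset_of_touchedFaceCoord {R : Set Z3} {x p : Z3}
    (h : ∀ j, TouchedFaceCoord (x j) (p j)) : cellVerts R x ⊆ cellVerts R p := by
  rintro w (hw | hw)
  · refine Or.inl ⟨hw.1, fun j => ?_⟩
    have h1 := h j
    have h2 := hw.2 j
    unfold TouchedFaceCoord at h1
    unfold VertexCoord at h2 ⊢
    omega
  · refine Or.inr ⟨fun j => ?_, hw.2⟩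
    have h1 := h j
    have h2 := hw.1 j
    unfold TouchedFaceCoord at h1
    omega

/-- A touched cell has an odd corner, and any cell having that corner as a vertex is touched by the
point it rounds to. -/
theorem touched_of_subset {R : Set Z3} {x p : Z3} (hx : Touched R x)
    (h : cellVerts R x ⊆ cellVerts R p) : Touched R p := by
  obtain ⟨v, hv, hvx⟩ := hx
  have h1 := odd_of_mem_cellVerts (h (cornerOver_mem hv hvx (Or.inl rfl)))
    (cornerOver_odd hvx (Or.inl rfl) 0)
  exact ⟨_, h1.2, isVertexOf_of_odd h1.1⟩

/-- The points representing cells, up to membership of `base p` in the domain of the complex. -/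
def Admissible (R : Set Z3) (p : Z3) : Prop := Touched R p ∨ ∀ j, 2 ∣ p j

/-- Equal vertex sets make both cells touched or both untouched; the coordinate conditions for
inclusion are antisymmetric in either case. -/
theorem cellVerts_injective {R : Set Z3} {x p : Z3} (hx : Admissible R x) (hp : Admissible R p)
    (h : cellVerts R x = cellVerts R p) : x = p := by
  by_cases hxt : Touched R x
  · have hpt := touched_of_subset hxt h.subset
    funext j
    have h1 := touchedFaceCoord_of_subset hxt h.subset j
    have h2 := touchedFaceCoord_of_subset hpt h.superset j
    unfold TouchedFaceCoord at h1 h2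
    omega
  · have hpt : ¬ Touched R p := fun hpt => hxt (touched_of_subset hpt h.superset)
    have hx2 := hx.resolve_left hxt
    have hp2 := hp.resolve_left hpt
    funext j
    have h1 := gridFaceCoord_of_subset hxt hx2 h.subset j
    have h2 := gridFaceCoord_of_subset hpt hp2 h.superset j
    have := baseCoord_spec (p j)
    have := baseCoord_spec (x j)
    have := hx2 j
    have := hp2 j
    unfold GridFaceCoord at h1 h2
    omega

/-! ### Codimension-one faces -/

theorem exists_unique_of_card_filter {P Q : Fin 3 → Prop} [DecidablePred P] [DecidablePred Q]
    (h : ∀ j, P j → Q j)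
    (hc : (Finset.univ.filter P).card + 1 = (Finset.univ.filter Q).card) :
    ∃ j, Q j ∧ ¬ P j ∧ ∀ i, i ≠ j → (P i ↔ Q i) := by
  have hs : Finset.univ.filter P ⊆ Finset.univ.filter Q := by
    intro j
    simpa using h j
  have h1 := Finset.card_sdiff_of_subset hs
  obtain ⟨j, hj⟩ := Finset.card_eq_one.1 (show (Finset.univ.filter Q \ Finset.univ.filter P).card
    = 1 by omega)
  have key : ∀ i, (Q i ∧ ¬ P i) ↔ i = j := by
    intro i
    have := congrArg (i ∈ ·) hj
    simpa using this
  refine ⟨j, ((key j).2 rfl).1, ((key j).2 rfl).2, fun i hi => ⟨h i, fun hq => ?_⟩⟩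
  by_contra hp
  exact hi ((key i).1 ⟨hq, hp⟩)

theorem card_filter_of_unique {P Q : Fin 3 → Prop} [DecidablePred P] [DecidablePred Q]
    {j : Fin 3} (hQ : Q j) (hP : ¬ P j) (h : ∀ i, i ≠ j → (P i ↔ Q i)) :
    (Finset.univ.filter P).card + 1 = (Finset.univ.filter Q).card := by
  have : Finset.univ.filter Q = insert j (Finset.univ.filter P) := by
    ext i
    by_cases hi : i = j
    · subst hi
      simp [hQ]
    · simp [hi, h i hi]
  rw [this, Finset.card_insert_of_notMem (by simp [hP])]

theorem even_of_mem_domQ {B : Set Z3} {q : Z3} (hq : q ∈ domQ B) (j : Fin 3) : 2 ∣ q j := by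
  obtain ⟨c, -, s, -, rfl⟩ := hq
  simp only [Pi.add_apply, Pi.smul_apply, smul_eq_mul]
  omega

theorem base_of_mem_domQ {B : Set Z3} {q : Z3} (hq : q ∈ domQ B) : base q = q :=
  base_of_even (even_of_mem_domQ hq)

theorem mem_domQ_of_gridFaceCoord {B : Set Z3} {x q : Z3} (hq : q ∈ domQ B)
    (h : ∀ j, GridFaceCoord (x j) (q j)) : x ∈ domQ B := by
  obtain ⟨c, hc, s, hs, rfl⟩ := hq
  refine ⟨c, hc, fun j => (x j - 4 * c j) / 2, fun j => ?_, funext fun j => ?_⟩ <;>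
  · have h1 := h j
    have h2 := hs j
    have h3 := baseCoord_spec (((4 : ℤ) • c + (2 : ℤ) • s) j)
    unfold GridFaceCoord at h1
    simp only [Pi.add_apply, Pi.smul_apply, smul_eq_mul] at h1 h3 ⊢
    omega

theorem exists_cube_of_mem_domQ {B : Set Z3} {q : Z3} (hq : q ∈ domQ B) :
    ∃ m ∈ domQ B, (∀ j, 4 ∣ m j) ∧ ∀ j, GridFaceCoord (q j) (m j) := by
  obtain ⟨c, hc, s, hs, rfl⟩ := hq
  refine ⟨(4 : ℤ) • c, ⟨c, hc, 0, fun j => Or.inl rfl, by simp⟩, fun j => ?_, fun j => ?_⟩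
  · simp
  · have h2 := hs j
    have h3 := baseCoord_spec (((4 : ℤ) • c) j)
    unfold GridFaceCoord
    simp only [Pi.add_apply, Pi.smul_apply, smul_eq_mul] at h3 ⊢
    omega

/-- The points representing the cells of the complex with the vertices in `R` repaired. -/
def repairedDom (B R : Set Z3) : Set Z3 := {p | base p ∈ domQ B ∧ Admissible R p}

/-- `x` represents a repaired codimension-one face of the repaired cell at `p`. -/
def IsTouchedFacet (R : Set Z3) (x p : Z3) : Prop :=
  Touched R x ∧ ∃ j, 2 ∣ p j ∧ (x j = p j + 1 ∨ x j = p j - 1) ∧ ∀ i, i ≠ j → x i = p i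

/-- `x` represents an untouched codimension-one face of the repaired cell at `p`. -/
def IsUntouchedFacet (R : Set Z3) (x p : Z3) : Prop :=
  ¬ Touched R x ∧ (∀ j, p j % 4 ≠ 2) ∧
    ∃ j, p j % 4 = 0 ∧ (x j = p j + 2 ∨ x j = p j - 2) ∧ ∀ i, i ≠ j → x i = baseCoord (p i)

theorem isFace_repairedCell {R : Set Z3} {x p : Z3} (hx : Admissible R x) (hp : Admissible R p) :
    IsFace (repairedCell R x) (repairedCell R p) ↔
      cellVerts R x ⊆ cellVerts R p ∧ x ≠ p ∧ cellDim R x ≤ cellDim R p := by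
  rw [repairedCell, repairedCell, isFace_cellOf, ssubset_iff_subset_ne, and_assoc]
  refine and_congr_right fun _ => and_congr_left fun _ => not_congr ⟨?_, ?_⟩
  · exact cellVerts_injective hx hp
  · rintro rfl
    rfl

/-- Along each axis the face condition only permits the dimension count to drop. A total drop of one
singles out one axis, and the coordinate conditions then determine `x` up to the sign of the step
along it. -/
theorem facet_iff_of_touched {R : Set Z3} {x p : Z3} (hp : Touched R p) :
    (Admissible R x ∧ cellDim R x + 1 = cellDim R p ∧
      IsFace (repairedCell R x) (repairedCell R p)) ↔
      IsTouchedFacet R x p ∨ IsUntouchedFacet R x p := by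
  constructor
  · rintro ⟨hx, hd, hf⟩
    rw [isFace_repairedCell hx (Or.inl hp)] at hf
    obtain ⟨hs, -, -⟩ := hf
    by_cases hxt : Touched R x
    · refine Or.inl ⟨hxt, ?_⟩
      have hc := touchedFaceCoord_of_subset hxt hs
      simp only [cellDim, hxt, hp, if_true] at hd
      unfold TouchedFaceCoord at hc
      have hPQ : ∀ j, 2 ∣ x j → 2 ∣ p j := fun j => by have := hc j; omega
      obtain ⟨j, h1, h2, h3⟩ := exists_unique_of_card_filter hPQ hd
      refine ⟨j, h1, ?_, fun i hi => ?_⟩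
      · have := hc j
        omega
      · have := hc i
        have := h3 i hi
        omega
    · refine Or.inr ⟨hxt, ?_⟩
      have hx2 := hx.resolve_left hxt
      have hc := gridFaceCoord_of_subset hxt hx2 hs
      simp only [cellDim, hxt, hp, if_true, if_false] at hd
      have hPQ : ∀ j, 4 ∣ x j → 2 ∣ p j := by
        intro j
        have h4 := hc j
        have := baseCoord_spec (p j)
        unfold GridFaceCoord at h4
        omega
      obtain ⟨j, h1, h2, h3⟩ := exists_unique_of_card_filter hPQ hd
      have hi : ∀ i, i ≠ j → p i % 4 ≠ 2 ∧ x i = baseCoord (p i) := by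
        intro i hi
        have h4 := hc i
        have h5 := h3 i hi
        have := baseCoord_spec (p i)
        unfold GridFaceCoord at h4
        omega
      -- If the axis of the drop were normal, no actual step would remain and `x` would equal `base
      -- p`, which is touched.
      have hj : p j % 4 = 0 := by
        by_contra hj
        refine hxt (touched_base.1 (?_ : Touched R (base x)))
        have : base x = base p := by
          rw [base_of_even hx2]
          funext i
          by_cases hij : i = j
          · subst hij
            have h4 := hc i
            unfold GridFaceCoord at h4
            exact h4.resolve_right (by omega)
          · exact (hi i hij).2
        rw [this]
        exact touched_base.2 hp
      refine ⟨fun i => ?_, j, hj, ?_, fun i hij => (hi i hij).2⟩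
      · by_cases hij : i = j
        · subst hij
          omega
        · exact (hi i hij).1
      · have h4 := hc j
        have := baseCoord_spec (p j)
        unfold GridFaceCoord at h4
        omega
  · rintro (⟨hxt, j, h1, h2, h3⟩ | ⟨hxt, h0, j, h1, h2, h3⟩)
    · have hd : cellDim R x + 1 = cellDim R p := by
        simp only [cellDim, hxt, hp, if_true]
        exact card_filter_of_unique (j := j) h1 (by omega) fun i hi => by rw [h3 i hi]
      refine ⟨Or.inl hxt, hd, ?_⟩
      rw [isFace_repairedCell (Or.inl hxt) (Or.inl hp)]
      refine ⟨subset_of_touchedFaceCoord fun i => ?_, ?_, by omega⟩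
      · by_cases hij : i = j
        · subst hij
          unfold TouchedFaceCoord
          omega
        · exact Or.inl (h3 i hij)
      · rintro rfl
        omega
    · have hx2 : ∀ i, 2 ∣ x i := by
        intro i
        by_cases hij : i = j
        · subst hij
          omega
        · have := h3 i hij
          have := h0 i
          have := baseCoord_spec (p i)
          omega
      have hd : cellDim R x + 1 = cellDim R p := by
        simp only [cellDim, hxt, hp, if_true, if_false]
        refine card_filter_of_unique (j := j) (by omega) (by omega) fun i hi => ?_
        have := h3 i hi
        have := h0 i
        have := baseCoord_spec (p i)
        omega
      refine ⟨Or.inr hx2, hd, ?_⟩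
      rw [isFace_repairedCell (Or.inr hx2) (Or.inl hp)]
      refine ⟨subset_of_gridFaceCoord hxt fun i => ?_, ?_, by omega⟩
      · by_cases hij : i = j
        · subst hij
          exact Or.inr ⟨h1, h2⟩
        · exact Or.inl (h3 i hij)
      · rintro rfl
        exact hxt hp

/-- Touchedness passes from faces to cofaces, so an untouched cell has only untouched faces and the
count is that of the cubical grid. -/
theorem facet_iff_of_not_touched {R : Set Z3} {x p : Z3} (hp : ¬ Touched R p)
    (hp2 : ∀ j, 2 ∣ p j) :
    (Admissible R x ∧ cellDim R x + 1 = cellDim R p ∧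
      IsFace (repairedCell R x) (repairedCell R p)) ↔
      ∃ j, 4 ∣ p j ∧ (x j = p j + 2 ∨ x j = p j - 2) ∧ ∀ i, i ≠ j → x i = p i := by
  constructor
  · rintro ⟨hx, hd, hf⟩
    rw [isFace_repairedCell hx (Or.inr hp2)] at hf
    obtain ⟨hs, -, -⟩ := hf
    have hxt : ¬ Touched R x := fun hxt => hp (touched_of_subset hxt hs)
    have hx2 := hx.resolve_left hxt
    have hc := gridFaceCoord_of_subset hxt hx2 hs
    have hk : ∀ j, x j = p j ∨ (p j % 4 = 0 ∧ (x j = p j + 2 ∨ x j = p j - 2)) := by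
      intro j
      have h4 := hc j
      have := baseCoord_spec (p j)
      have := hp2 j
      unfold GridFaceCoord at h4
      omega
    simp only [cellDim, hxt, hp, if_false] at hd
    have hPQ : ∀ j, 4 ∣ x j → 4 ∣ p j := fun j => by have := hk j; omega
    obtain ⟨j, h1, h2, h3⟩ := exists_unique_of_card_filter hPQ hd
    refine ⟨j, h1, ?_, fun i hi => ?_⟩
    · have := hk j
      omega
    · have := hk i
      have := h3 i hi
      omega
  · rintro ⟨j, h1, h2, h3⟩
    have hc : ∀ i, GridFaceCoord (x i) (p i) := by
      intro i
      by_cases hij : i = j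
      · subst hij
        exact Or.inr ⟨by omega, h2⟩
      · have := baseCoord_spec (p i)
        have := hp2 i
        have := h3 i hij
        unfold GridFaceCoord
        omega
    have hx2 : ∀ i, 2 ∣ x i := by
      intro i
      by_cases hij : i = j
      · subst hij
        omega
      · rw [h3 i hij]
        exact hp2 i
    have hxt := not_touched_of_gridFaceCoord hc hp
    have hd : cellDim R x + 1 = cellDim R p := by
      simp only [cellDim, hxt, hp, if_false]
      exact card_filter_of_unique (j := j) h1 (by omega) fun i hi => by rw [h3 i hi]
    refine ⟨Or.inr hx2, hd, ?_⟩
    rw [isFace_repairedCell (Or.inr hx2) (Or.inr hp2)]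
    refine ⟨subset_of_gridFaceCoord hxt hc, ?_, by omega⟩
    rintro rfl
    omega

/-- A unit step from an even coordinate rounds to nothing at a normal coordinate and to a step of
two at a multiple of four; either way the grid cell of origin is a face of the old one or equal to
it. -/
theorem gridFaceCoord_baseCoord {a b : ℤ} (hb : 2 ∣ b) (h : a = b + 1 ∨ a = b - 1) :
    GridFaceCoord (baseCoord a) (baseCoord b) := by
  have hb' : baseCoord b = b := by
    have := baseCoord_spec b
    omega
  rw [hb', GridFaceCoord, hb']
  have := baseCoord_spec a
  rcases h with rfl | rfl <;> omega

theorem baseCoord_baseCoord (b : ℤ) : baseCoord (baseCoord b) = baseCoord b := by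
  have h1 := baseCoord_spec b
  have h2 := baseCoord_spec (baseCoord b)
  omega

theorem IsTouchedFacet.base_mem {B R : Set Z3} {x p : Z3} (h : IsTouchedFacet R x p)
    (hp : base p ∈ domQ B) : base x ∈ domQ B := by
  obtain ⟨-, j, h1, h2, h3⟩ := h
  refine mem_domQ_of_gridFaceCoord hp fun i => ?_
  by_cases hij : i = j
  · subst hij
    exact gridFaceCoord_baseCoord h1 h2
  · simp only [base, h3 i hij]
    exact Or.inl (baseCoord_baseCoord _).symm

theorem IsUntouchedFacet.base_mem {B R : Set Z3} {x p : Z3} (h : IsUntouchedFacet R x p)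
    (hp : base p ∈ domQ B) : base x ∈ domQ B := by
  obtain ⟨-, -, j, h1, h2, h3⟩ := h
  refine mem_domQ_of_gridFaceCoord hp fun i => ?_
  by_cases hij : i = j
  · subst hij
    have h4 := baseCoord_spec (p i)
    have h5 := baseCoord_spec (x i)
    exact Or.inr (by simp only [base]; omega)
  · simp only [base, h3 i hij, baseCoord_baseCoord]
    exact Or.inl (baseCoord_baseCoord _).symm

/-! ### Colors, touched neighbours and completeness -/

open Classical in
/-- The colors representing the complex with the vertices in `R` repaired. -/
noncomputable def repairedColor (B R : Set Z3) (p : Z3) : ℤ :=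
  if p ∈ repairedDom B R then (cellDim R p : ℤ) else -1

theorem cellDim_le (R : Set Z3) (p : Z3) : cellDim R p ≤ 3 := by
  unfold cellDim
  split_ifs <;> exact Finset.card_filter_le _ _

/-- A vertex in `R` touching `p` lies two units above or below `p` along this axis, and moving one
unit towards it keeps it a vertex. Hence at most one side along the axis can be a gap. -/
theorem touched_update {R : Set Z3} {p : Z3} (hp : Touched R p) {j : Fin 3} (hj : p j % 4 = 0) :
    Touched R (Function.update p j (p j + 1)) ∨ Touched R (Function.update p j (p j - 1)) := by
  obtain ⟨v, hv, hvp⟩ := hp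
  have h1 := hvp j
  unfold VertexCoord at h1
  have key : ∀ a, VertexCoord (v j) a → IsVertexOf v (Function.update p j a) := by
    intro a ha i
    by_cases hij : i = j
    · subst hij
      simpa using ha
    · simpa [hij] using hvp i
  by_cases h : v j = p j + 2
  · refine Or.inl ⟨v, hv, key _ ?_⟩
    unfold VertexCoord
    omega
  · refine Or.inr ⟨v, hv, key _ ?_⟩
    unfold VertexCoord
    omega

theorem touched_update_of_mod_two {R : Set Z3} {p : Z3} (hp : Touched R p) {j : Fin 3}
    (hj : p j % 4 = 2) {a : ℤ} (ha : a = p j + 1 ∨ a = p j - 1) :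
    Touched R (Function.update p j a) := by
  obtain ⟨v, hv, hvp⟩ := hp
  refine ⟨v, hv, fun i => ?_⟩
  have h1 := hvp i
  by_cases hij : i = j
  · subst hij
    unfold VertexCoord at h1 ⊢
    simp only [Function.update_self]
    omega
  · simpa [hij] using h1

/-- A touched cell of dimension below three is a face of the polyhedron at `base x`; an untouched
one is a face of the cell at the centre of an incident cube. -/
theorem isComplete_repaired (B R : Set Z3) :
    IsComplete (repairedCell R '' repairedDom B R) := by
  rintro _ ⟨⟨x, ⟨hxB, hx⟩, rfl⟩, hmax⟩
  by_contra hne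
  obtain ⟨m, hm, hm4, hmf⟩ := exists_cube_of_mem_domQ hxB
  have hm2 : ∀ j, 2 ∣ m j := fun j => by have := hm4 j; omega
  -- All coordinates of the centre are multiples of four, so both dimension formulas give three and
  -- it is irrelevant whether the cube is touched.
  have hdim : ∀ R, cellDim R m = 3 := by
    intro R
    unfold cellDim
    simp [hm4, hm2]
  have hdm : (repairedCell R x).dim = cellDim R x := rfl
  have hle := cellDim_le R x
  by_cases hxt : Touched R x
  · have hbx2 := even_of_mem_domQ hxB
    have hbt := touched_base.2 hxt
    have hb : base x ∈ repairedDom B R := ⟨by rwa [base_of_mem_domQ hxB], Or.inl hbt⟩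
    have hd : cellDim R (base x) = 3 := by
      unfold cellDim
      simp [hbt, hbx2]
    refine hmax _ ⟨_, hb, rfl⟩ ?_
    rw [isFace_repairedCell hx hb.2]
    refine ⟨subset_of_touchedFaceCoord fun j => ?_, fun h => ?_, by omega⟩
    · have := baseCoord_spec (x j)
      unfold TouchedFaceCoord
      simp only [base]
      omega
    · rw [← h] at hd
      omega
  · have hx2 := hx.resolve_left hxt
    refine hmax _ ⟨m, ⟨by rwa [base_of_mem_domQ hm], Or.inr hm2⟩, rfl⟩ ?_
    rw [isFace_repairedCell hx (Or.inr hm2)]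
    rw [base_of_even hx2] at hmf
    refine ⟨subset_of_gridFaceCoord hxt hmf, fun h => ?_, by rw [hdim]; omega⟩
    have := hdim R
    rw [← h] at this
    omega

/-! Structuring elements given by predicates. -/

open Classical in
/-- The structuring element with value `i` at the origin, `i - 1` at the points satisfying `F`,
and `-1` at the other points satisfying `E`. -/
noncomputable def predElement (i : ℤ) (F E : Z3 → Prop) : StructuringElement 3 where
  toFun x := if x = 0 then some i else if F x then some (i - 1)
    else if E x then some (-1) else none
  zero_mem := by simp

theorem StructuringElement.toFun_injective :
    Function.Injective (StructuringElement.toFun (n := 3)) := by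
  rintro ⟨f, hf⟩ ⟨g, hg⟩ rfl
  rfl

theorem element_eq_predElement {i : ℤ} {F E : List Z3} {P Q : Z3 → Prop}
    (hF : ∀ x, x ∈ F ↔ P x) (hE : ∀ x, x ∈ E ↔ Q x) : element i F E = predElement i P Q := by
  apply StructuringElement.toFun_injective
  funext x
  by_cases h1 : x = 0 <;> by_cases h2 : P x <;> by_cases h3 : Q x <;>
    simp [element, predElement, hF, hE, h1, h2, h3]

theorem transform_predElement {i : ℤ} {F E F' E' : Z3 → Prop} {π : Equiv.Perm (Fin 3)}
    {u : Fin 3 → ℤˣ} (hF : ∀ x, F (fun j => (u j : ℤ) * x (π j)) ↔ F' x)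
    (hE : ∀ x, E (fun j => (u j : ℤ) * x (π j)) ↔ E' x) :
    (predElement i F E).transform π u = predElement i F' E' := by
  apply StructuringElement.toFun_injective
  funext x
  have h0 : (fun j => (u j : ℤ) * x (π j)) = 0 ↔ x = 0 := by
    constructor
    · intro h
      funext j
      have := congrFun h (π.symm j)
      simpa using this
    · rintro rfl
      funext j
      simp
  simp only [StructuringElement.transform, predElement]
  by_cases h1 : x = 0
  · rw [if_pos h1, if_pos (h0.2 h1)]
  · rw [if_neg h1, if_neg (mt h0.1 h1)]
    by_cases h2 : F' x <;> by_cases h3 : E' x <;> simp only [hF, hE, h2, h3, if_true, if_false]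

/-- The points with value `i - 1` of `repairElement`. -/
def RepairFacet (t s : Z3) (φ : Prop) (x : Z3) : Prop :=
  (∃ j, s j = 0 ∧ (x j = 1 ∨ x j = -1) ∧ x j ≠ t j ∧ ∀ i, i ≠ j → x i = 0) ∨
    (φ ∧ ∃ j, t j ≠ 0 ∧ x j = 2 * t j ∧ ∀ i, i ≠ j → x i = - s i)

/-- The points with value `-1` of `repairElement`. -/
def RepairGap (t x : Z3) : Prop := ∃ j, t j ≠ 0 ∧ x j = t j ∧ ∀ i, i ≠ j → x i = 0

/-- The structuring element of a repaired cell: `s` is the direction of the cell as a face of a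
thickened cell, `t` gives the directions of the faces without repaired vertices. -/
noncomputable def repairElement (t s : Z3) (φ : Prop) : StructuringElement 3 :=
  predElement (Finset.univ.filter (fun j => s j = 0)).card (RepairFacet t s φ) (RepairGap t)

/-- The structuring element of a cell of the cubical grid with the directions `f`. -/
noncomputable def gridElement (f : Fin 3 → Bool) : StructuringElement 3 :=
  predElement (Finset.univ.filter (fun j => f j = true)).card
    (fun x => ∃ j, f j = true ∧ (x j = 2 ∨ x j = -2) ∧ ∀ i, i ≠ j → x i = 0)
    (fun x => ∃ j, f j = true ∧ (x j = 1 ∨ x j = -1) ∧ ∀ i, i ≠ j → x i = 0)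

/-! ### Behaviour of the local patterns under signed permutations -/

theorem card_filter_perm (P : Fin 3 → Prop) [DecidablePred P] (π : Equiv.Perm (Fin 3)) :
    (Finset.univ.filter (fun j => P (π j))).card = (Finset.univ.filter P).card :=
  Finset.card_bij' (fun j _ => π j) (fun j _ => π.symm j) (by simp) (by simp) (by simp) (by simp)

theorem forall_ne_perm {Q : Fin 3 → Prop} (π : Equiv.Perm (Fin 3)) (j : Fin 3) :
    (∀ i, i ≠ j → Q (π i)) ↔ ∀ i, i ≠ π j → Q i := by
  rw [← π.forall_congr_right (q := fun i => i ≠ π j → Q i)]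
  simp only [ne_eq, π.injective.eq_iff]

theorem exists_perm {P : Fin 3 → Prop} {Q : Fin 3 → Fin 3 → Prop} (π : Equiv.Perm (Fin 3)) :
    (∃ j, P (π j) ∧ ∀ i, i ≠ j → Q (π j) (π i)) ↔ ∃ j, P j ∧ ∀ i, i ≠ j → Q j i := by
  rw [← π.exists_congr_right (q := fun j => P j ∧ ∀ i, i ≠ j → Q j i)]
  simp only [forall_ne_perm (Q := Q _) π]

theorem transform_gridElement (f : Fin 3 → Bool) (π : Equiv.Perm (Fin 3)) :
    (gridElement (f ∘ π)).transform π 1 = gridElement f := by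
  have h : (Finset.univ.filter (fun j => (f ∘ π) j = true)).card =
    (Finset.univ.filter (fun j => f j = true)).card := card_filter_perm (fun j => f j = true) π
  unfold gridElement
  rw [h]
  apply transform_predElement <;>
  · intro x
    simp only [Pi.one_apply, Units.val_one, one_mul, Function.comp, ← and_assoc]
    first
      | exact exists_perm (P := fun j => f j = true ∧ (x j = 2 ∨ x j = -2))
          (Q := fun _ i => x i = 0) π
      | exact exists_perm (P := fun j => f j = true ∧ (x j = 1 ∨ x j = -1))
          (Q := fun _ i => x i = 0) π

/-- The pattern is written through equalities and zero tests that involve one axis and its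
complement, so changing signs and permuting axes acts on the parameters alone. -/
theorem transform_repairElement (t s : Z3) (φ : Prop) (π : Equiv.Perm (Fin 3)) (u : Fin 3 → ℤˣ) :
    (repairElement (fun j => u j * t (π j)) (fun j => u j * s (π j)) φ).transform π u =
      repairElement t s φ := by
  have h : (Finset.univ.filter (fun j => (u j : ℤ) * s (π j) = 0)).card =
      (Finset.univ.filter (fun j => s j = 0)).card := by
    rw [← card_filter_perm (fun j => s j = 0) π]
    congr 2
    simp
  unfold repairElement
  rw [h]
  have hu : ∀ j, (u j : ℤ) = 1 ∨ (u j : ℤ) = -1 := fun j => by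
    rcases Int.units_eq_one_or (u j) with h | h <;> simp [h]
  have e1 : ∀ j (a : ℤ), (u j : ℤ) * a = 0 ↔ a = 0 := by simp
  have e2 : ∀ j (a : ℤ), ((u j : ℤ) * a = 1 ∨ (u j : ℤ) * a = -1) ↔ (a = 1 ∨ a = -1) := by
    intro j a
    rcases hu j with h | h <;> rw [h] <;> omega
  have e3 : ∀ j (a b : ℤ), (u j : ℤ) * a = (u j : ℤ) * b ↔ a = b := by simp
  have e4 : ∀ j (a b : ℤ), (u j : ℤ) * a = 2 * ((u j : ℤ) * b) ↔ a = 2 * b := by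
    intro j a b
    rcases hu j with h | h <;> rw [h] <;> omega
  have e5 : ∀ j (a b : ℤ), (u j : ℤ) * a = - ((u j : ℤ) * b) ↔ a = - b := by
    intro j a b
    rcases hu j with h | h <;> rw [h] <;> omega
  apply transform_predElement
  · intro x
    simp only [RepairFacet, ne_eq, e1, e2, e3, e4, e5, ← and_assoc]
    exact or_congr
      (exists_perm (P := fun j => (s j = 0 ∧ (x j = 1 ∨ x j = -1)) ∧ ¬ x j = t j)
        (Q := fun _ i => x i = 0) π)
      (and_congr_right' (exists_perm (P := fun j => ¬ t j = 0 ∧ x j = 2 * t j)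
        (Q := fun _ i => x i = - s i) π))
  · intro x
    simp only [RepairGap, ne_eq, e1, e3, ← and_assoc]
    exact exists_perm (P := fun j => ¬ t j = 0 ∧ x j = t j) (Q := fun _ i => x i = 0) π

/-! ### Matching normal forms with the base list -/

theorem eq_vec_iff (x : Z3) (a b c : ℤ) : x = ![a, b, c] ↔ x 0 = a ∧ x 1 = b ∧ x 2 = c := by
  constructor
  · rintro rfl
    simp
  · rintro ⟨rfl, rfl, rfl⟩
    funext j
    fin_cases j <;> rfl

theorem exists_fin_three {P : Fin 3 → Prop} : (∃ j, P j) ↔ P 0 ∨ P 1 ∨ P 2 := by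
  simp [Fin.exists_fin_succ]

theorem forall_ne_fin_three {P : Fin 3 → Prop} :
    ((∀ i, i ≠ (0 : Fin 3) → P i) ↔ P 1 ∧ P 2) ∧ ((∀ i, i ≠ (1 : Fin 3) → P i) ↔ P 0 ∧ P 2) ∧
      ((∀ i, i ≠ (2 : Fin 3) → P i) ↔ P 0 ∧ P 1) := by
  simp [Fin.forall_fin_succ]

theorem card_filter_fin_three (P : Fin 3 → Prop) [DecidablePred P] :
    (Finset.univ.filter P).card =
      (if P 0 then 1 else 0) + (if P 1 then 1 else 0) + (if P 2 then 1 else 0) := by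
  rw [Finset.card_filter, Fin.sum_univ_three]

theorem eq_vec_of_fin_three {α : Type*} (f : Fin 3 → α) : f = ![f 0, f 1, f 2] := by
  funext j
  fin_cases j <;> rfl

theorem gridElement_eq_element {a b c : Bool} {i : ℤ} {F E : List Z3}
    (hi : ((if a then 1 else 0) + (if b then 1 else 0) + (if c then 1 else 0) : ℕ) = i)
    (hF : ∀ x, x ∈ F ↔ (a = true ∧ (x 0 = 2 ∨ x 0 = -2) ∧ x 1 = 0 ∧ x 2 = 0) ∨
      (b = true ∧ (x 1 = 2 ∨ x 1 = -2) ∧ x 0 = 0 ∧ x 2 = 0) ∨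
      (c = true ∧ (x 2 = 2 ∨ x 2 = -2) ∧ x 0 = 0 ∧ x 1 = 0))
    (hE : ∀ x, x ∈ E ↔ (a = true ∧ (x 0 = 1 ∨ x 0 = -1) ∧ x 1 = 0 ∧ x 2 = 0) ∨
      (b = true ∧ (x 1 = 1 ∨ x 1 = -1) ∧ x 0 = 0 ∧ x 2 = 0) ∨
      (c = true ∧ (x 2 = 1 ∨ x 2 = -1) ∧ x 0 = 0 ∧ x 1 = 0)) :
    gridElement ![a, b, c] = element i F E := by
  subst hi
  rw [gridElement, card_filter_fin_three]
  refine (element_eq_predElement (fun x => ?_) (fun x => ?_)).symm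
  · rw [hF, exists_fin_three]
    simp only [forall_ne_fin_three]
    rfl
  · rw [hE, exists_fin_three]
    simp only [forall_ne_fin_three]
    rfl

/-- An antitone Boolean triple is one of four, giving the kept vertices, edges, squares and cubes.
-/
theorem gridElement_mem_baseElements {f : Fin 3 → Bool} (hf : Antitone f) :
    gridElement f ∈ baseElements := by
  have h01 : f 1 ≤ f 0 := hf (by decide)
  have h12 : f 2 ≤ f 1 := hf (by decide)
  rw [eq_vec_of_fin_three f]
  generalize f 0 = a at *
  generalize f 1 = b at *
  generalize f 2 = c at *
  cases a <;> cases b <;> cases c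
  all_goals first | exact absurd h01 (by decide) | exact absurd h12 (by decide) | skip
  · rw [gridElement_eq_element (i := 0) (F := []) (E := []) rfl (by simp) (by simp)]
    exact List.getElem_mem (l := baseElements) (n := 0) (by simp [baseElements])
  · refine (gridElement_eq_element rfl (fun x => ?_) (fun x => ?_)) ▸
      List.getElem_mem (l := baseElements) (n := 1) (by simp [baseElements])
    all_goals
      simp only [List.mem_cons, List.not_mem_nil, eq_vec_iff, or_false, true_and]
      simp
      try omega
  · refine (gridElement_eq_element rfl (fun x => ?_) (fun x => ?_)) ▸
      List.getElem_mem (l := baseElements) (n := 4) (by simp [baseElements])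
    all_goals
      simp only [List.mem_cons, List.not_mem_nil, eq_vec_iff, or_false, true_and]
      simp
      try omega
  · refine (gridElement_eq_element rfl (fun x => ?_) (fun x => ?_)) ▸
      List.getElem_mem (l := baseElements) (n := 9) (by simp [baseElements])
    all_goals
      simp only [List.mem_cons, List.not_mem_nil, eq_vec_iff, or_false, true_and]
      try omega

theorem repairElement_eq_element {t s : Z3} {φ : Prop} {i : ℤ} {F E : List Z3}
    (hi : (((if s 0 = 0 then 1 else 0) + (if s 1 = 0 then 1 else 0) +
      (if s 2 = 0 then 1 else 0) : ℕ) : ℤ) = i)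
    (hF : ∀ x, x ∈ F ↔ ((s 0 = 0 ∧ (x 0 = 1 ∨ x 0 = -1) ∧ x 0 ≠ t 0 ∧ x 1 = 0 ∧ x 2 = 0) ∨
      (s 1 = 0 ∧ (x 1 = 1 ∨ x 1 = -1) ∧ x 1 ≠ t 1 ∧ x 0 = 0 ∧ x 2 = 0) ∨
      (s 2 = 0 ∧ (x 2 = 1 ∨ x 2 = -1) ∧ x 2 ≠ t 2 ∧ x 0 = 0 ∧ x 1 = 0)) ∨
      (φ ∧ ((t 0 ≠ 0 ∧ x 0 = 2 * t 0 ∧ x 1 = - s 1 ∧ x 2 = - s 2) ∨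
      (t 1 ≠ 0 ∧ x 1 = 2 * t 1 ∧ x 0 = - s 0 ∧ x 2 = - s 2) ∨
      (t 2 ≠ 0 ∧ x 2 = 2 * t 2 ∧ x 0 = - s 0 ∧ x 1 = - s 1))))
    (hE : ∀ x, x ∈ E ↔ ((t 0 ≠ 0 ∧ x 0 = t 0 ∧ x 1 = 0 ∧ x 2 = 0) ∨
      (t 1 ≠ 0 ∧ x 1 = t 1 ∧ x 0 = 0 ∧ x 2 = 0) ∨ (t 2 ≠ 0 ∧ x 2 = t 2 ∧ x 0 = 0 ∧ x 1 = 0))) :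
    repairElement t s φ = element i F E := by
  subst hi
  rw [repairElement, card_filter_fin_three]
  refine (element_eq_predElement (fun x => ?_) (fun x => ?_)).symm
  · rw [hF, RepairFacet, exists_fin_three, exists_fin_three]
    simp only [forall_ne_fin_three]
  · rw [hE, RepairGap, exists_fin_three]
    simp only [forall_ne_fin_three]

theorem monotone_fin_three_cases : ∀ a b c : Fin 3, a ≤ b → b ≤ c →
      (a = 0 ∧ b = 0 ∧ c = 0) ∨
      (a = 0 ∧ b = 0 ∧ c = 1) ∨
      (a = 0 ∧ b = 0 ∧ c = 2) ∨
      (a = 0 ∧ b = 1 ∧ c = 1) ∨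
      (a = 0 ∧ b = 1 ∧ c = 2) ∨
      (a = 0 ∧ b = 2 ∧ c = 2) ∨
      (a = 1 ∧ b = 1 ∧ c = 1) ∨
      (a = 1 ∧ b = 1 ∧ c = 2) ∨
      (a = 1 ∧ b = 2 ∧ c = 2) ∨
      (a = 2 ∧ b = 2 ∧ c = 2) := by
  decide

/-- `κ j` is `0`, `1`, `2` for coordinates with a gap, without one, and normal to the cell. -/
theorem repairElement_mem_baseElements {κ : Fin 3 → Fin 3} (hκ : Monotone κ) {φ : Prop}
    (hφ : (∀ j, κ j ≠ 1) → φ) :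
    repairElement (fun j => if κ j = 0 then 1 else 0) (fun j => if κ j = 2 then 1 else 0) φ ∈
      baseElements := by
  -- Kept facets can be forbidden only by an even coordinate that is `2` modulo `4`; such an axis
  -- has type `1`. Without type `1`, `φ` is therefore forced.
  have hφ' : ∀ {a b c : Fin 3}, κ 0 = a → κ 1 = b → κ 2 = c → a ≠ 1 → b ≠ 1 → c ≠ 1 → φ := by
    rintro a b c rfl rfl rfl h0 h1 h2
    refine hφ fun j => ?_
    fin_cases j
    exacts [h0, h1, h2]
  have hmem : ∀ n (hn : n < 16), baseElements[n] ∈ baseElements := fun n hn =>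
    List.getElem_mem (l := baseElements) (n := n) hn
  rcases monotone_fin_three_cases _ _ _ (hκ (show (0 : Fin 3) ≤ 1 by decide))
    (hκ (show (1 : Fin 3) ≤ 2 by decide)) with
    ⟨h0, h1, h2⟩ | ⟨h0, h1, h2⟩ | ⟨h0, h1, h2⟩ | ⟨h0, h1, h2⟩ | ⟨h0, h1, h2⟩ | ⟨h0, h1, h2⟩ | ⟨h0, h1, h2⟩ | ⟨h0, h1, h2⟩ | ⟨h0, h1, h2⟩ | ⟨h0, h1, h2⟩
  · have h : φ := hφ' h0 h1 h2 (by decide) (by decide) (by decide)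
    rw [repairElement_eq_element (i := 3) (F := [![2, 0, 0], ![-1, 0, 0], ![0, 2, 0], ![0, -1, 0], ![0, 0, 2], ![0, 0, -1]])
      (E := [![1, 0, 0], ![0, 1, 0], ![0, 0, 1]])]
    · exact hmem 15 (by norm_num)
    all_goals
      simp only [h0, h1, h2, h, List.mem_cons, List.not_mem_nil, eq_vec_iff]
      simp
    all_goals
      intro x
      grind
  -- Here `φ` is free and separates a hexahedron with two unit squares from `p₁`, which has no kept
  -- facet.
  · by_cases h : φ
    · rw [repairElement_eq_element (i := 3) (F := [![2, 0, 0], ![-1, 0, 0], ![0, 2, 0], ![0, -1, 0], ![0, 0, 1], ![0, 0, -1]])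
        (E := [![1, 0, 0], ![0, 1, 0]])]
      · exact hmem 14 (by norm_num)
      all_goals
        simp only [h0, h1, h2, h, List.mem_cons, List.not_mem_nil, eq_vec_iff]
        simp
      all_goals
        intro x
        grind
    · rw [repairElement_eq_element (i := 3) (F := [![-1, 0, 0], ![0, -1, 0], ![0, 0, 1], ![0, 0, -1]])
        (E := [![1, 0, 0], ![0, 1, 0]])]
      · exact hmem 12 (by norm_num)
      all_goals
        simp only [h0, h1, h2, h, List.mem_cons, List.not_mem_nil, eq_vec_iff]
        simp
      all_goals
        intro x
        grind
  · have h : φ := hφ' h0 h1 h2 (by decide) (by decide) (by decide)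
    rw [repairElement_eq_element (i := 2) (F := [![-1, 0, 0], ![0, -1, 0], ![2, 0, -1], ![0, 2, -1]])
      (E := [![1, 0, 0], ![0, 1, 0]])]
    · exact hmem 7 (by norm_num)
    all_goals
      simp only [h0, h1, h2, h, List.mem_cons, List.not_mem_nil, eq_vec_iff]
      simp
    all_goals
      intro x
      grind
  · by_cases h : φ
    · rw [repairElement_eq_element (i := 3) (F := [![2, 0, 0], ![-1, 0, 0], ![0, 1, 0], ![0, -1, 0], ![0, 0, 1], ![0, 0, -1]])
        (E := [![1, 0, 0]])]
      · exact hmem 13 (by norm_num)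
      all_goals
        simp only [h0, h1, h2, h, List.mem_cons, List.not_mem_nil, eq_vec_iff]
        simp
      all_goals
        intro x
        grind
    · rw [repairElement_eq_element (i := 3) (F := [![-1, 0, 0], ![0, 1, 0], ![0, -1, 0], ![0, 0, 1], ![0, 0, -1]])
        (E := [![1, 0, 0]])]
      · exact hmem 11 (by norm_num)
      all_goals
        simp only [h0, h1, h2, h, List.mem_cons, List.not_mem_nil, eq_vec_iff]
        simp
      all_goals
        intro x
        grind
  · by_cases h : φ
    · rw [repairElement_eq_element (i := 2) (F := [![-1, 0, 0], ![0, 1, 0], ![0, -1, 0], ![2, 0, -1]])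
        (E := [![1, 0, 0]])]
      · exact hmem 8 (by norm_num)
      all_goals
        simp only [h0, h1, h2, h, List.mem_cons, List.not_mem_nil, eq_vec_iff]
        simp
      all_goals
        intro x
        grind
    · rw [repairElement_eq_element (i := 2) (F := [![-1, 0, 0], ![0, 1, 0], ![0, -1, 0]])
        (E := [![1, 0, 0]])]
      · exact hmem 6 (by norm_num)
      all_goals
        simp only [h0, h1, h2, h, List.mem_cons, List.not_mem_nil, eq_vec_iff]
        simp
      all_goals
        intro x
        grind
  · have h : φ := hφ' h0 h1 h2 (by decide) (by decide) (by decide)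
    rw [repairElement_eq_element (i := 1) (F := [![-1, 0, 0], ![2, -1, -1]])
      (E := [![1, 0, 0]])]
    · exact hmem 3 (by norm_num)
    all_goals
      simp only [h0, h1, h2, h, List.mem_cons, List.not_mem_nil, eq_vec_iff]
      simp
    all_goals
      intro x
      grind
  -- With no gap direction the kept-facet clause is empty, so `φ` has no influence in this case and
  -- the ones below.
  · rw [repairElement_eq_element (i := 3) (F := [![1, 0, 0], ![-1, 0, 0], ![0, 1, 0], ![0, -1, 0], ![0, 0, 1], ![0, 0, -1]])
      (E := [])]
    · exact hmem 10 (by norm_num)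
    all_goals
      simp only [h0, h1, h2, List.mem_cons, List.not_mem_nil, eq_vec_iff]
      simp
    all_goals
      intro x
      grind
  · rw [repairElement_eq_element (i := 2) (F := [![1, 0, 0], ![-1, 0, 0], ![0, 1, 0], ![0, -1, 0]])
      (E := [])]
    · exact hmem 5 (by norm_num)
    all_goals
      simp only [h0, h1, h2, List.mem_cons, List.not_mem_nil, eq_vec_iff]
      simp
    all_goals
      intro x
      grind
  · rw [repairElement_eq_element (i := 1) (F := [![1, 0, 0], ![-1, 0, 0]])
      (E := [])]
    · exact hmem 2 (by norm_num)
    all_goals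
      simp only [h0, h1, h2, List.mem_cons, List.not_mem_nil, eq_vec_iff]
      simp
    all_goals
      intro x
      grind
  · have h : φ := hφ' h0 h1 h2 (by decide) (by decide) (by decide)
    rw [repairElement_eq_element (i := 0) (F := []) (E := [])]
    · exact hmem 0 (by norm_num)
    all_goals
      simp only [h0, h1, h2, h, List.not_mem_nil]
      simp

/-- Sorting the negated Boolean values moves the directions of the cell to the front. -/
theorem gridElement_mem_structuringElementsP (f : Fin 3 → Bool) :
    gridElement f ∈ structuringElementsP := by
  have hm : Antitone (f ∘ Tuple.sort (fun j => !f j)) := by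
    intro i j hij
    have h := Tuple.monotone_sort (fun j => !f j) hij
    simp only [Function.comp] at h ⊢
    revert h
    cases f (Tuple.sort (fun j => !f j) i) <;> cases f (Tuple.sort (fun j => !f j) j) <;> decide
  exact ⟨_, gridElement_mem_baseElements hm, _, _, (transform_gridElement f _).symm⟩

theorem repairElement_mem_structuringElementsP {t s : Z3} (ht : IsSign t) (hs : IsSign s)
    (hts : ∀ j, t j = 0 ∨ s j = 0) {φ : Prop} (hφ : (∀ j, t j ≠ 0 ∨ s j ≠ 0) → φ) :
    repairElement t s φ ∈ structuringElementsP := by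
  set k : Fin 3 → Fin 3 := fun j => if t j ≠ 0 then 0 else if s j ≠ 0 then 2 else 1 with hk
  set π := Tuple.sort k with hπ
  have hm : Monotone (k ∘ π) := Tuple.monotone_sort k
  -- The supports of `t` and `s` are disjoint, so one sign per axis makes both nonnegative.
  set u : Fin 3 → ℤˣ := fun j => if t (π j) = -1 ∨ s (π j) = -1 then -1 else 1 with hu
  have ht' : (fun j => (u j : ℤ) * t (π j)) = fun j => if (k ∘ π) j = 0 then 1 else 0 := by
    funext j
    simp only [hu, hk, Function.comp]
    rcases ht (π j) with h | h | h <;> rcases hs (π j) with h' | h' | h' <;>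
      simp [h, h'] <;> have := hts (π j) <;> omega
  have hs' : (fun j => (u j : ℤ) * s (π j)) = fun j => if (k ∘ π) j = 2 then 1 else 0 := by
    funext j
    simp only [hu, hk, Function.comp]
    rcases ht (π j) with h | h | h <;> rcases hs (π j) with h' | h' | h' <;>
      simp [h, h'] <;> have := hts (π j) <;> omega
  refine ⟨_, repairElement_mem_baseElements hm (φ := φ) fun h => hφ fun j => ?_, π, u, ?_⟩
  · have := h (π.symm j)
    simp only [Function.comp, Equiv.apply_symm_apply, hk] at this
    by_contra hj
    push Not at hj
    simp [hj.1, hj.2] at this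
  · rw [← ht', ← hs', transform_repairElement]

/-! ### Uniqueness: the gaps are determined by the facets -/

/-- The points at which the value of an element of `structuringElementsP` with value `i - 1`
exactly on `S` is `-1`. -/
def Gap (S : Set Z3) (x : Z3) : Prop :=
  x ⬝ᵥ x = 1 ∧ (-x ∈ S ∨ ∃ f ∈ S, f ⬝ᵥ x = 2)

open Classical in
/-- The value `-1` is taken exactly at the gaps of the set of points with value `i - 1`. -/
def GapsDetermined (b : StructuringElement 3) : Prop :=
  ∃ i : ℤ, b.toFun 0 = some i ∧ ∀ x, x ≠ 0 → b.toFun x ≠ some (i - 1) →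
    b.toFun x = if Gap {y | b.toFun y = some (i - 1)} x then some (-1) else none

theorem GapsDetermined.ext {b b' : StructuringElement 3} (h : GapsDetermined b)
    (h' : GapsDetermined b') {i : ℤ} (h0 : b.toFun 0 = some i) (h0' : b'.toFun 0 = some i)
    (hS : ∀ x, b.toFun x = some (i - 1) ↔ b'.toFun x = some (i - 1)) : b = b' := by
  obtain ⟨k, hk, h⟩ := h
  obtain ⟨k', hk', h'⟩ := h'
  obtain rfl : i = k := by simpa [h0] using hk
  obtain rfl : i = k' := by simpa [h0'] using hk'
  apply StructuringElement.toFun_injective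
  funext x
  by_cases hx : x = 0
  · rw [hx, h0, h0']
  by_cases hb : b.toFun x = some (i - 1)
  · rw [hb, (hS x).1 hb]
  · rw [h x hx hb, h' x hx (fun h => hb ((hS x).2 h))]
    rw [show {y | b.toFun y = some (i - 1)} = {y | b'.toFun y = some (i - 1)} from Set.ext hS]

theorem mem_units_of_dotProduct {x : Z3} (h : x ⬝ᵥ x = 1) :
    x ∈ [![1, 0, 0], ![-1, 0, 0], ![0, 1, 0], ![0, -1, 0], ![0, 0, 1], ![0, 0, -1]] := by
  simp only [dotProduct, Fin.sum_univ_three] at h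
  have key : ∀ a b c : ℤ, a * a + b * b + c * c = 1 → a = 0 ∨ a = 1 ∨ a = -1 := by
    intro a b c h
    have h1 : a ≤ 1 := by nlinarith [mul_self_nonneg b, mul_self_nonneg c]
    have h2 : -1 ≤ a := by nlinarith [mul_self_nonneg b, mul_self_nonneg c]
    omega
  have h0 := key _ _ _ h
  have h1 := key (x 1) (x 0) (x 2) (by linarith)
  have h2 := key (x 2) (x 0) (x 1) (by linarith)
  simp only [List.mem_cons, List.not_mem_nil, eq_vec_iff]
  rcases h0 with h0 | h0 | h0 <;> rcases h1 with h1 | h1 | h1 <;>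
    rcases h2 with h2 | h2 | h2 <;> simp [h0, h1, h2] at h ⊢

/-- The hypotheses reduce the claim to a finite check on the six unit vectors. The case `i = 0`
needs separate treatment because `i - 1` then coincides with the gap value; there both lists are
empty. -/
theorem gapsDetermined_element {i : ℤ} {F E : List Z3} (h0 : (0 : Z3) ∉ F)
    (hi : i = 0 → F = [] ∧ E = [])
    (hE : ∀ x ∈ [![1, 0, 0], ![-1, 0, 0], ![0, 1, 0], ![0, -1, 0], ![0, 0, 1], ![0, 0, -1]],
      x ∉ F → (x ∈ E ↔ -x ∈ F ∨ ∃ f ∈ F, f 0 * x 0 + f 1 * x 1 + f 2 * x 2 = 2))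
    (hU : ∀ x ∈ E, x 0 * x 0 + x 1 * x 1 + x 2 * x 2 = 1) :
    GapsDetermined (element i F E) := by
  refine ⟨i, by simp [element], fun x hx hF => ?_⟩
  by_cases hi0 : i = 0
  · obtain ⟨rfl, rfl⟩ := hi hi0
    subst hi0
    have hS : ∀ y, (element 0 [] []).toFun y ≠ some (0 - 1) := by
      intro y
      by_cases hy : y = 0 <;> simp [element, hy]
    rw [if_neg]
    · simp [element, hx]
    · rintro ⟨-, h | ⟨f, h, -⟩⟩
      · exact hS _ h
      · exact hS _ h
  · have hS : {y | (element i F E).toFun y = some (i - 1)} = {y | y ∈ F} := by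
      ext y
      simp only [element, Set.mem_ofPred_eq]
      by_cases hy : y = 0
      · simp only [hy, h0, if_true, Option.some.injEq, iff_false]
        omega
      · by_cases hyF : y ∈ F
        · simp [hy, hyF]
        · by_cases hyE : y ∈ E
          · simp only [hy, hyF, hyE, if_true, if_false, Option.some.injEq, iff_false]
            omega
          · simp [hy, hyF, hyE]
    rw [hS]
    have hxF : x ∉ F := by
      intro h
      exact hF (by simp [element, hx, h])
    have hg : x ∈ E ↔ Gap {y | y ∈ F} x := by
      simp only [Gap, dotProduct, Fin.sum_univ_three, Set.mem_ofPred_eq]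
      constructor
      · intro h
        have hu := hU x h
        refine ⟨hu, (hE x (mem_units_of_dotProduct ?_) hxF).1 h⟩
        simpa only [dotProduct, Fin.sum_univ_three] using hu
      · rintro ⟨hu, h⟩
        refine (hE x (mem_units_of_dotProduct ?_) hxF).2 h
        simpa only [dotProduct, Fin.sum_univ_three] using hu
    by_cases hxE : x ∈ E
    · rw [if_pos (hg.1 hxE)]
      simp [element, hx, hxF, hxE]
    · rw [if_neg (mt hg.2 hxE)]
      simp [element, hx, hxF, hxE]

theorem gapsDetermined_baseElements : ∀ b ∈ baseElements, GapsDetermined b := by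
  simp only [baseElements, List.forall_mem_cons, List.not_mem_nil, IsEmpty.forall_iff,
    implies_true, and_true]
  refine ⟨?_, ?_, ?_, ?_, ?_, ?_, ?_, ?_, ?_, ?_, ?_, ?_, ?_, ?_, ?_, ?_⟩ <;>
    exact gapsDetermined_element (by decide) (by decide) (by decide) (by decide)

/-- The symmetry of `ℤ³` used in `StructuringElement.transform`. -/
def signedPerm (π : Equiv.Perm (Fin 3)) (u : Fin 3 → ℤˣ) : Z3 ≃ Z3 where
  toFun x j := u j * x (π j)
  invFun y i := u (π.symm i) * y (π.symm i)
  left_inv x := by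
    funext i
    simp only [Equiv.apply_symm_apply, ← mul_assoc, ← Units.val_mul, Int.units_mul_self,
      Units.val_one, one_mul]
  right_inv y := by
    funext i
    simp only [Equiv.symm_apply_apply, ← mul_assoc, ← Units.val_mul, Int.units_mul_self,
      Units.val_one, one_mul]

theorem dotProduct_signedPerm (π : Equiv.Perm (Fin 3)) (u : Fin 3 → ℤˣ) (x y : Z3) :
    signedPerm π u x ⬝ᵥ signedPerm π u y = x ⬝ᵥ y := by
  have h : ∀ j, signedPerm π u x j * signedPerm π u y j = x (π j) * y (π j) := by
    intro j
    have hu : (u j : ℤ) * u j = 1 := by simp [← Units.val_mul, Int.units_mul_self]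
    simp only [signedPerm, Equiv.coe_fn_mk]
    linear_combination (x (π j) * y (π j)) * hu
  simp only [dotProduct, h]
  exact Equiv.sum_comp π (fun j => x j * y j)

/-- The gap rule uses only negation and the scalar product, both preserved by signed permutations.
This extends the check on the base list to all of `B_P`. -/
theorem gap_signedPerm (π : Equiv.Perm (Fin 3)) (u : Fin 3 → ℤˣ) (S : Set Z3) (x : Z3) :
    Gap S (signedPerm π u x) ↔ Gap (signedPerm π u ⁻¹' S) x := by
  have hneg : -signedPerm π u x = signedPerm π u (-x) := by
    funext j
    simp [signedPerm]
  simp only [Gap, dotProduct_signedPerm, hneg, Set.mem_preimage]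
  refine and_congr_right fun _ => or_congr_right ?_
  rw [← (signedPerm π u).exists_congr_right]
  simp only [dotProduct_signedPerm]

theorem gapsDetermined_of_mem {b : StructuringElement 3} (hb : b ∈ structuringElementsP) :
    GapsDetermined b := by
  obtain ⟨b₀, hb₀, π, u, rfl⟩ := hb
  obtain ⟨i, h0, h⟩ := gapsDetermined_baseElements b₀ hb₀
  have ht : ∀ x, (b₀.transform π u).toFun x = b₀.toFun (signedPerm π u x) := fun _ => rfl
  have hz : signedPerm π u 0 = 0 := by
    funext j
    simp [signedPerm]
  refine ⟨i, by rw [ht, hz, h0], fun x hx hF => ?_⟩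
  rw [ht] at hF ⊢
  have hx' : signedPerm π u x ≠ 0 := by
    rw [← hz]
    exact (signedPerm π u).injective.ne hx
  rw [h _ hx' hF, gap_signedPerm]
  rfl

/-! ### Detection at a point of the domain -/

/-- A criterion for `Detects`. -/
theorem detects_predElement {D : Set Z3} {h : Z3 → Cell 3} {g : Z3 → ℤ} {p : Z3} {F E : Z3 → Prop}
    (hp : g p = (h p).dim) (hD : ∀ x ∈ D, g x = (h x).dim)
    (hF : ∀ x, F (x - p) ↔ x ∈ D ∧ (h x).dim + 1 = (h p).dim ∧ IsFace (h x) (h p))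
    (hE : ∀ x, E (x - p) → g x = -1) (hE0 : ∀ x, E x → (h p).dim ≠ 0) :
    Detects D h g p (predElement (h p).dim F E) := by
  have hF0 : ¬ F 0 := by
    intro h0
    have := ((hF p).1 (by rwa [sub_self])).2.1
    omega
  have hF' : ∀ x, F x → g (x + p) = ((h p).dim : ℤ) - 1 := by
    intro x hx
    obtain ⟨h1, h2, -⟩ := (hF (x + p)).1 (by rwa [add_sub_cancel_right])
    rw [hD _ h1]
    omega
  refine ⟨fun x k hk => ?_, fun x k hx hk => ?_, fun x => ?_⟩
  · simp only [predElement] at hk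
    split_ifs at hk with h1 h2 h3
    · rw [h1, zero_add, hp]
      simpa using hk.symm
    · rw [hF' x h2]
      simpa using hk.symm
    · rw [hE (x + p) (by rwa [add_sub_cancel_right])]
      simpa using hk.symm
  · simp only [predElement] at hk
    split_ifs at hk with h1 h2 h3
    · exact absurd h1 hx
    · exact Or.inl (by simpa using hk.symm)
    · exact Or.inr (by simpa using hk.symm)
  · rw [← hF]
    simp only [predElement]
    by_cases h1 : x - p = 0
    · simp only [h1, hF0, if_true, Option.some.injEq, iff_false]
      omega
    · by_cases h2 : F (x - p)
      · simp [h1, h2]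
      · by_cases h3 : E (x - p)
        -- In dimension zero a gap value `-1` would be read as a facet; `hE0` excludes this.
        · have := hE0 _ h3
          simp only [h1, h2, h3, if_true, if_false, Option.some.injEq, iff_false]
          omega
        · simp [h1, h2, h3]

/-- The fitting condition fixes the value at the origin and the face condition fixes the level set
`i - 1`. By `GapsDetermined.ext` nothing else is free. -/
theorem existsUnique_of_detects {D : Set Z3} {h : Z3 → Cell 3} {g : Z3 → ℤ} {p : Z3}
    {b : StructuringElement 3} (hp : g p = (h p).dim) (hb : b ∈ structuringElementsP)
    (hd : Detects D h g p b) : ∃! b, b ∈ structuringElementsP ∧ Detects D h g p b := by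
  refine ⟨b, ⟨hb, hd⟩, fun b' ⟨hb', hd'⟩ => ?_⟩
  have h0 : ∀ c : StructuringElement 3, Detects D h g p c → c.toFun 0 = some ((h p).dim : ℤ) := by
    intro c hc
    obtain ⟨k, hk⟩ := Option.ne_none_iff_exists'.1 c.zero_mem
    have := hc.fits 0 k hk
    rw [zero_add, hp] at this
    rw [hk, this]
  refine (gapsDetermined_of_mem hb').ext (gapsDetermined_of_mem hb) (h0 _ hd') (h0 _ hd)
    fun x => ?_
  have h1 := hd.faces (x + p)
  have h2 := hd'.faces (x + p)
  rw [add_sub_cancel_right] at h1 h2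
  rw [h1, h2]

theorem repairedColor_eq_neg_one {B R : Set Z3} {x : Z3} (hx : ¬ Touched R x) {j : Fin 3}
    (hj : ¬ 2 ∣ x j) : repairedColor B R x = -1 := by
  rw [repairedColor, if_neg]
  rintro ⟨-, h⟩
  exact hj (h.resolve_left hx j)

/-- The direction, along the `j`-th axis, of the face without repaired vertices. -/
noncomputable def gapDirection (R : Set Z3) (p : Z3) : Z3 := by
  classical
  exact fun j => if p j % 4 = 0 then
    if ¬ Touched R (Function.update p j (p j + 1)) then 1
    else if ¬ Touched R (Function.update p j (p j - 1)) then -1 else 0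
  else 0

/-- Since at least one side is touched, the order of the two tests in the definition is harmless,
and each sign characterizes an untouched side. -/
theorem gapDirection_spec {R : Set Z3} {p : Z3} (hp : Touched R p) (j : Fin 3) :
    (p j % 4 ≠ 0 → gapDirection R p j = 0) ∧
    (p j % 4 = 0 → (gapDirection R p j = 1 ↔ ¬ Touched R (Function.update p j (p j + 1))) ∧
      (gapDirection R p j = -1 ↔ ¬ Touched R (Function.update p j (p j - 1)))) ∧
    (gapDirection R p j = 0 ∨ gapDirection R p j = 1 ∨ gapDirection R p j = -1) := by
  by_cases h : p j % 4 = 0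
  · have := touched_update hp h
    by_cases h1 : Touched R (Function.update p j (p j + 1)) <;>
      by_cases h2 : Touched R (Function.update p j (p j - 1)) <;>
      simp_all [gapDirection]
  · simp [gapDirection, h]

theorem repairFacet_iff {R : Set Z3} {p x : Z3} (hp : Touched R p) :
    RepairFacet (gapDirection R p) (p - base p) (∀ j, p j % 4 ≠ 2) (x - p) ↔
      IsTouchedFacet R x p ∨ IsUntouchedFacet R x p := by
  have hs : ∀ j, (p - base p) j = 0 ↔ 2 ∣ p j := by
    intro j
    have := baseCoord_spec (p j)
    simp only [Pi.sub_apply, base]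
    omega
  have hupd : ∀ {j}, (∀ i, i ≠ j → x i = p i) → x = Function.update p j (x j) := by
    intro j h
    funext i
    by_cases hij : i = j
    · subst hij
      simp
    · simp [hij, h i hij]
  -- Both points round to the same grid cell. A kept facet two steps away is thus untouched exactly
  -- when the unit neighbour of `p` on that side is.
  have hbase : ∀ {j}, (∀ i, i ≠ j → x i = baseCoord (p i)) → ∀ a, x j = baseCoord a →
      (Touched R x ↔ Touched R (Function.update p j a)) := by
    intro j h a ha
    rw [← touched_base (p := Function.update p j a)]
    suffices x = base (Function.update p j a) by rw [this]
    funext i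
    by_cases hij : i = j
    · subst hij
      simp [base, ha]
    · simp [base, hij, h i hij]
  refine or_congr ?_ ?_
  · unfold IsTouchedFacet
    rw [← exists_and_left]
    refine exists_congr fun j => ?_
    obtain ⟨h1, h2, h3⟩ := gapDirection_spec hp j
    rw [hs]
    simp only [Pi.sub_apply, sub_eq_zero]
    constructor
    · rintro ⟨h4, h5, h6, h7⟩
      refine ⟨?_, h4, by omega, h7⟩
      by_cases h0 : p j % 4 = 0
      · obtain ⟨h2, h2'⟩ := h2 h0
        by_contra hx
        rw [hupd h7] at hx
        rcases h5 with h5 | h5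
        · rw [show x j = p j + 1 by omega, ← h2] at hx
          omega
        · rw [show x j = p j - 1 by omega, ← h2'] at hx
          omega
      · rw [hupd h7]
        exact touched_update_of_mod_two hp (by omega) (by omega)
    · rintro ⟨hx, h4, h5, h7⟩
      refine ⟨h4, by omega, fun h6 => ?_, h7⟩
      by_cases h0 : p j % 4 = 0
      · obtain ⟨h2, h2'⟩ := h2 h0
        rw [hupd h7] at hx
        rcases h5 with h5 | h5
        · rw [h5] at hx
          exact h2.1 (by omega) hx
        · rw [h5] at hx
          exact h2'.1 (by omega) hx
      · have := h1 h0
        omega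
  · unfold IsUntouchedFacet
    rw [and_left_comm]
    refine and_congr_right fun h0 => ?_
    rw [← exists_and_left]
    refine exists_congr fun j => ?_
    obtain ⟨h1, h2, h3⟩ := gapDirection_spec hp j
    have e : ∀ i, (x - p) i = - (p - base p) i ↔ x i = baseCoord (p i) := by
      intro i
      simp only [Pi.sub_apply, base]
      omega
    simp only [e]
    simp only [Pi.sub_apply]
    constructor
    · rintro ⟨h4, h5, h6⟩
      by_cases hj : p j % 4 = 0
      · obtain ⟨h2, h2'⟩ := h2 hj
        refine ⟨?_, hj, by omega, h6⟩
        rcases h3.resolve_left h4 with h3 | h3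
        · rw [hbase h6 (p j + 1) (by have := baseCoord_spec (p j + 1); omega), ← h2]
          exact h3
        · rw [hbase h6 (p j - 1) (by have := baseCoord_spec (p j - 1); omega), ← h2']
          exact h3
      · exact absurd (h1 hj) h4
    · rintro ⟨hx, hj, h5, h6⟩
      obtain ⟨h2, h2'⟩ := h2 hj
      rcases h5 with h5 | h5
      · rw [hbase h6 (p j + 1) (by have := baseCoord_spec (p j + 1); omega), ← h2] at hx
        exact ⟨by omega, by omega, h6⟩
      · rw [hbase h6 (p j - 1) (by have := baseCoord_spec (p j - 1); omega), ← h2'] at hx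
        exact ⟨by omega, by omega, h6⟩

/-- The facet part is the classification of codimension-one faces. The gap part holds because a gap
point is untouched and has an odd coordinate, hence color `-1`. -/
theorem exists_detects {B R : Set Z3} {h : Z3 → Cell 3}
    (hh : ∀ x ∈ repairedDom B R, h x = repairedCell R x) {p : Z3} (hp : p ∈ repairedDom B R) :
    ∃ b ∈ structuringElementsP, Detects (repairedDom B R) h (repairedColor B R) p b := by
  have hdim : ∀ x ∈ repairedDom B R, (h x).dim = cellDim R x := fun x hx => by rw [hh x hx]; rfl
  have hg : ∀ x ∈ repairedDom B R, repairedColor B R x = (h x).dim := by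
    intro x hx
    rw [hdim x hx, repairedColor, if_pos hx]
  have hface : ∀ x, (x ∈ repairedDom B R ∧ (h x).dim + 1 = (h p).dim ∧ IsFace (h x) (h p)) ↔
      base x ∈ domQ B ∧ Admissible R x ∧ cellDim R x + 1 = cellDim R p ∧
        IsFace (repairedCell R x) (repairedCell R p) := by
    intro x
    rw [← and_assoc (a := base x ∈ domQ B)]
    refine and_congr_right fun hx => ?_
    rw [hdim x hx, hdim p hp, hh x hx, hh p hp]
  have hpd := hdim p hp
  by_cases hpt : Touched R p
  · refine ⟨repairElement (gapDirection R p) (p - base p) (∀ j, p j % 4 ≠ 2),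
      repairElement_mem_structuringElementsP (fun j => (gapDirection_spec hpt j).2.2) ?_ ?_ ?_, ?_⟩
    · intro j
      have := baseCoord_spec (p j)
      simp only [Pi.sub_apply, base]
      omega
    · intro j
      have := baseCoord_spec (p j)
      have := (gapDirection_spec hpt j).1
      simp only [Pi.sub_apply, base]
      omega
    · intro h j
      have := baseCoord_spec (p j)
      have := (gapDirection_spec hpt j).1
      have := h j
      simp only [Pi.sub_apply, base] at this
      omega
    · have hs : ∀ j, (p - base p) j = 0 ↔ 2 ∣ p j := by
        intro j
        have := baseCoord_spec (p j)
        simp only [Pi.sub_apply, base]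
        omega
      have hd : (Finset.univ.filter (fun j => (p - base p) j = 0)).card = (h p).dim := by
        rw [hpd, cellDim, if_pos hpt]
        simp only [hs]
      rw [repairElement, hd]
      refine detects_predElement (hg p hp) hg (fun x => ?_) (fun x => ?_) (fun x => ?_)
      · rw [hface, facet_iff_of_touched hpt, repairFacet_iff hpt]
        refine (and_iff_right_of_imp ?_).symm
        rintro (h | h)
        · exact h.base_mem hp.1
        · exact h.base_mem hp.1
      · rintro ⟨j, h1, h2, h3⟩
        obtain ⟨h4, h5, h6⟩ := gapDirection_spec hpt j
        have h0 : p j % 4 = 0 := by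
          by_contra h0
          exact h1 (h4 h0)
        obtain ⟨h5, h5'⟩ := h5 h0
        simp only [Pi.sub_apply, sub_eq_zero] at h2 h3
        have hupd : ∀ a, x j = a → x = Function.update p j a := by
          intro a ha
          funext i
          by_cases hij : i = j
          · subst hij
            simp [ha]
          · simp [hij, h3 i hij]
        refine repairedColor_eq_neg_one (j := j) ?_ (by omega)
        rcases h6.resolve_left h1 with h6 | h6
        · rw [hupd (p j + 1) (by omega)]
          exact h5.1 h6
        · rw [hupd (p j - 1) (by omega)]
          exact h5'.1 h6
      · rintro ⟨j, h1, -⟩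
        rw [← hd]
        refine (Finset.card_pos.2 ⟨j, ?_⟩).ne'
        have := (gapDirection_spec hpt j).1
        simp only [Finset.mem_filter, Finset.mem_univ, true_and, hs]
        omega
  · have hp2 := hp.2.resolve_left hpt
    refine ⟨gridElement (fun j => decide (4 ∣ p j)), gridElement_mem_structuringElementsP _, ?_⟩
    have hd : (Finset.univ.filter (fun j => decide ((4 : ℤ) ∣ p j) = true)).card = (h p).dim := by
      rw [hpd, cellDim, if_neg hpt]
      simp only [decide_eq_true_eq]
    rw [gridElement, hd]
    refine detects_predElement (hg p hp) hg (fun x => ?_) (fun x => ?_) (fun x => ?_)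
    · rw [hface, facet_iff_of_not_touched hpt hp2]
      simp only [decide_eq_true_eq, Pi.sub_apply, sub_eq_zero]
      constructor
      · rintro ⟨j, h1, h2, h3⟩
        refine ⟨mem_domQ_of_gridFaceCoord hp.1 fun i => ?_, j, h1, by omega, h3⟩
        have hb := baseCoord_baseCoord (p i)
        have h4 := baseCoord_spec (p i)
        have h5 := baseCoord_spec (x i)
        have := hp2 i
        simp only [base, GridFaceCoord, hb]
        by_cases hij : i = j
        · subst hij
          omega
        · rw [h3 i hij]
          exact Or.inl rfl
      · rintro ⟨-, j, h1, h2, h3⟩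
        exact ⟨j, h1, by omega, h3⟩
    · rintro ⟨j, h1, h2, h3⟩
      simp only [decide_eq_true_eq, Pi.sub_apply, sub_eq_zero] at h1 h2 h3
      refine repairedColor_eq_neg_one (j := j) ?_ (by omega)
      rintro ⟨v, hv, hvx⟩
      -- A unit step along a free axis only restricts the vertices of the grid cell, so a repaired
      -- vertex at `x` would already touch `p`.
      refine hpt ⟨v, hv, fun i => ?_⟩
      have h4 := hvx i
      by_cases hij : i = j
      · subst hij
        unfold VertexCoord at h4 ⊢
        omega
      · rwa [h3 i hij] at h4
    · rintro ⟨j, h1, -⟩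
      rw [← hd]
      exact (Finset.card_pos.2 ⟨j, by simpa using h1⟩).ne'

theorem isECMRepresentation_repaired {B R : Set Z3} {h : Z3 → Cell 3}
    (hh : ∀ x ∈ repairedDom B R, h x = repairedCell R x) :
    IsECMRepresentation (repairedCell R '' repairedDom B R) (repairedDom B R) h
      (repairedColor B R) structuringElementsP where
  complete := isComplete_repaired B R
  bijective := by
    refine Set.BijOn.congr (f₁ := repairedCell R) ?_ fun x hx => (hh x hx).symm
    refine Set.InjOn.bijOn_image fun x hx y hy hxy => ?_
    exact cellVerts_injective hx.2 hy.2 (cellOf_inj.1 hxy).2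
  color_range p := by
    have := cellDim_le R p
    unfold repairedColor
    split_ifs
    · exact ⟨by omega, by exact_mod_cast this⟩
    · norm_num
  color_mem p hp := by
    rw [repairedColor, if_pos hp, hh p hp]
    rfl
  color_notMem p hp := if_neg hp
  structuring p hp := by
    obtain ⟨b, hb, hd⟩ := exists_detects hh hp
    refine existsUnique_of_detects ?_ hb hd
    rw [repairedColor, if_pos hp, hh p hp]
    rfl

/-! ### The cubical complex in the same coordinates -/

theorem hQ_eq_cellOf {x : Z3} (hx : ∀ j, 2 ∣ x j) :
    hQ x = cellOf (Finset.univ.filter (fun j => (4 : ℤ) ∣ x j)).card {w | IsVertexOf w x} := by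
  unfold hQ
  congr 1
  ext w
  refine forall_congr' fun j => ?_
  have := hx j
  unfold VertexCoord
  split_ifs <;> omega

/-- Besides covering the kept cells, this allows the choice `R = ∅`, under which injectivity and the
face relation of the grid are special cases of the repaired theory. -/
theorem hQ_eq_repairedCell {R : Set Z3} {x : Z3} (hx : ∀ j, 2 ∣ x j) (hxt : ¬ Touched R x) :
    hQ x = repairedCell R x := by
  rw [hQ_eq_cellOf hx, repairedCell, cellVerts_of_not_touched hxt, cellDim, if_neg hxt]

theorem cubicalComplex_eq (B : Set Z3) : cubicalComplex B = hQ '' domQ B := by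
  ext σ
  constructor
  · rintro ⟨c, hc, s, hs, rfl⟩
    exact ⟨_, ⟨c, hc, s, hs, rfl⟩, hQ_eq c s hs⟩
  · rintro ⟨_, ⟨c, hc, s, hs, rfl⟩, rfl⟩
    exact ⟨c, hc, s, hs, hQ_eq c s hs⟩

theorem gQ_eq {B : Set Z3} {x : Z3} (hx : x ∈ domQ B) :
    gQ B x = (Finset.univ.filter (fun j => (4 : ℤ) ∣ x j)).card := by
  rw [gQ, if_pos hx]
  rfl

theorem gridFaceCoord_even {a b : ℤ} (hb : 2 ∣ b) :
    GridFaceCoord a b ↔ a = b ∨ (b % 4 = 0 ∧ (a = b + 2 ∨ a = b - 2)) := by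
  have := baseCoord_spec b
  unfold GridFaceCoord
  omega

theorem hQ_injOn {x q : Z3} (hx : ∀ j, 2 ∣ x j) (hq : ∀ j, 2 ∣ q j) (h : hQ x = hQ q) :
    x = q := by
  rw [hQ_eq_repairedCell (R := ∅) hx (by simp [Touched]),
    hQ_eq_repairedCell (R := ∅) hq (by simp [Touched])] at h
  exact cellVerts_injective (Or.inr hx) (Or.inr hq) (cellOf_inj.1 h).2

theorem isFace_hQ {x q : Z3} (hx : ∀ j, 2 ∣ x j) (hq : ∀ j, 2 ∣ q j) :
    IsFace (hQ x) (hQ q) ↔ (∀ j, GridFaceCoord (x j) (q j)) ∧ x ≠ q := by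
  have h0 : ∀ y, ¬ Touched ∅ y := by simp [Touched]
  rw [hQ_eq_repairedCell hx (h0 x), hQ_eq_repairedCell hq (h0 q),
    isFace_repairedCell (Or.inr hx) (Or.inr hq)]
  constructor
  · rintro ⟨h1, h2, -⟩
    exact ⟨gridFaceCoord_of_subset (h0 x) hx h1, h2⟩
  · rintro ⟨h1, h2⟩
    refine ⟨subset_of_gridFaceCoord (h0 x) h1, h2, ?_⟩
    simp only [cellDim, h0, if_false]
    refine Finset.card_le_card fun j => ?_
    have := (gridFaceCoord_even (hq j)).1 (h1 j)
    simp only [Finset.mem_filter, Finset.mem_univ, true_and]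
    omega

theorem isVertexOf_iff_gridFaceCoord {p q : Z3} (hq : ∀ j, 2 ∣ q j) :
    IsVertexOf p q ↔ (∀ j, p j % 4 = 2) ∧ ∀ j, GridFaceCoord (p j) (q j) := by
  rw [← forall_and]
  refine forall_congr' fun j => ?_
  rw [gridFaceCoord_even (hq j)]
  have := hq j
  unfold VertexCoord
  omega

theorem card_filter_eq (P : Fin 3 → Prop) [DecidablePred P] :
    ((Finset.univ.filter P).card = 0 ↔ ∀ j, ¬ P j) ∧
    ((Finset.univ.filter P).card = 1 ↔ ∃ i, P i ∧ ∀ j, j ≠ i → ¬ P j) ∧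
    ((Finset.univ.filter P).card = 2 ↔ ∃ i, ¬ P i ∧ ∀ j, j ≠ i → P j) ∧
    ((Finset.univ.filter P).card = 3 ↔ ∀ j, P j) := by
  rw [card_filter_fin_three, exists_fin_three, exists_fin_three]
  simp only [Fin.forall_fin_succ]
  by_cases h0 : P 0 <;> by_cases h1 : P 1 <;> by_cases h2 : P 2 <;> simp [h0, h1, h2]

/-- This is all the proof needs about critical vertices: they lie in `Q` and have dimension zero. -/
theorem criticalReps_spec {B : Set Z3} {p : Z3} (hp : p ∈ criticalReps B) :
    p ∈ domQ B ∧ ∀ j, p j % 4 = 2 := by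
  refine ⟨hp.1, fun j => ?_⟩
  have h := hp.2.1
  rw [gQ_eq hp.1] at h
  have := (card_filter_eq _).1.1 (by exact_mod_cast h) j
  have := even_of_mem_domQ hp.1 j
  omega

theorem mem_starReps {B : Set Z3} {p q : Z3} (hp : p ∈ criticalReps B) :
    q ∈ starReps B p ↔ q ∈ domQ B ∧ IsVertexOf p q := by
  refine and_congr_right fun hq => ?_
  have hq2 := even_of_mem_domQ hq
  obtain ⟨hpd, hp4⟩ := criticalReps_spec hp
  have hp2 := even_of_mem_domQ hpd
  rw [isVertexOf_iff_gridFaceCoord hq2]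
  simp only [starIn, Set.mem_singleton_iff, exists_eq_left, Set.mem_ofPred_eq, cubicalComplex_eq]
  rw [isFace_hQ hp2 hq2]
  constructor
  · rintro ⟨-, h | h⟩
    · obtain rfl := hQ_injOn hp2 hq2 h
      exact ⟨hp4, fun j => (gridFaceCoord_even (hp2 j)).2 (Or.inl rfl)⟩
    · exact ⟨hp4, h.1⟩
  · rintro ⟨-, h⟩
    refine ⟨⟨q, hq, rfl⟩, ?_⟩
    by_cases hpq : p = q
    · exact Or.inl (by rw [hpq])
    · exact Or.inr ⟨h, hpq⟩

theorem mem_faceReps {B : Set Z3} {x q : Z3} {i : ℤ} (hq : q ∈ domQ B) :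
    x ∈ faceReps B q i ↔ (∀ j, GridFaceCoord (x j) (q j)) ∧ x ≠ q ∧
      ((Finset.univ.filter (fun j => (4 : ℤ) ∣ x j)).card : ℤ) = i := by
  have hq2 := even_of_mem_domQ hq
  constructor
  · rintro ⟨h1, h2, h3⟩
    rw [isFace_hQ (even_of_mem_domQ h1) hq2] at h3
    exact ⟨h3.1, h3.2, by rwa [← gQ_eq h1]⟩
  · rintro ⟨h1, h2, h3⟩
    have hx := mem_domQ_of_gridFaceCoord hq h1
    exact ⟨hx, by rwa [gQ_eq hx], (isFace_hQ (even_of_mem_domQ hx) hq2).2 ⟨h1, h2⟩⟩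

theorem mem_faceReps_zero {B : Set Z3} {x q : Z3} (hq : q ∈ domQ B) :
    x ∈ faceReps B q 0 ↔ IsVertexOf x q ∧ x ≠ q := by
  have hq2 := even_of_mem_domQ hq
  rw [mem_faceReps hq, isVertexOf_iff_gridFaceCoord hq2]
  have : ((Finset.univ.filter (fun j => (4 : ℤ) ∣ x j)).card : ℤ) = 0 ↔ ∀ j, ¬ (4 : ℤ) ∣ x j := by
    rw [← (card_filter_eq _).1]
    norm_cast
  rw [this]
  constructor
  · rintro ⟨h1, h2, h3⟩
    refine ⟨⟨fun j => ?_, h1⟩, h2⟩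
    have := h3 j
    have := (gridFaceCoord_even (hq2 j)).1 (h1 j)
    have := hq2 j
    omega
  · rintro ⟨⟨h1, h2⟩, h3⟩
    exact ⟨h2, h3, fun j => by have := h1 j; omega⟩

/-- `q` represents an edge in the direction of the axis `d` with distinct vertices represented
by `p` and `p₁`. -/
def IsEdgeBetween (p q p₁ : Z3) (d : Fin 3) : Prop :=
  4 ∣ q d ∧ (p d = q d + 2 ∨ p d = q d - 2) ∧ p₁ d = 2 * q d - p d ∧
    ∀ i, i ≠ d → q i % 4 = 2 ∧ p i = q i ∧ p₁ i = q i

theorem isCriticalEdge_iff {B : Set Z3} {p q p₁ : Z3} :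
    IsCriticalEdge B p q p₁ ↔
      p ∈ criticalReps B ∧ q ∈ domQ B ∧ ∃ d, IsEdgeBetween p q p₁ d := by
  refine and_congr_right fun hp => ?_
  rw [mem_starReps hp, and_assoc]
  refine and_congr_right fun hq => ?_
  have hq2 := even_of_mem_domQ hq
  rw [gQ_eq hq, mem_faceReps_zero hq]
  have : ((Finset.univ.filter (fun j => (4 : ℤ) ∣ q j)).card : ℤ) = 1 ↔
      ∃ i, (4 : ℤ) ∣ q i ∧ ∀ j, j ≠ i → ¬ (4 : ℤ) ∣ q j := by
    rw [← (card_filter_eq _).2.1]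
    norm_cast
  rw [this]
  constructor
  · rintro ⟨h1, ⟨d, hd, h2⟩, ⟨h3, -⟩, h4⟩
    have key : ∀ i, i ≠ d → q i % 4 = 2 ∧ p i = q i ∧ p₁ i = q i := by
      intro i hi
      have e1 := h1 i
      have e2 := h2 i hi
      have e3 := h3 i
      have := hq2 i
      unfold VertexCoord at e1 e3
      omega
    have hne : p₁ d ≠ p d := by
      intro h
      refine h4 (funext fun i => ?_)
      by_cases hi : i = d
      · rw [hi, h]
      · rw [(key i hi).2.1, (key i hi).2.2]
    have e1 := h1 d
    have e3 := h3 d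
    unfold VertexCoord at e1 e3
    exact ⟨d, hd, by omega, by omega, key⟩
  · rintro ⟨d, hd, h1, h2, h3⟩
    have hv : ∀ v : Z3, (v d = q d + 2 ∨ v d = q d - 2) → (∀ i, i ≠ d → v i = q i) →
        IsVertexOf v q := by
      intro v hv hv' i
      unfold VertexCoord
      by_cases hi : i = d
      · subst hi
        omega
      · have := hv' i hi
        have := h3 i hi
        omega
    refine ⟨hv p h1 fun i hi => (h3 i hi).2.1, ⟨d, hd, fun i hi => ?_⟩,
      ⟨hv p₁ (by omega) fun i hi => (h3 i hi).2.2, fun h => ?_⟩, fun h => ?_⟩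
    · have := h3 i hi
      omega
    · rw [h] at h2
      omega
    · rw [h] at h2
      omega

theorem IsEdgeBetween.eq_or_eq {p q p₁ w : Z3} {d : Fin 3} (h : IsEdgeBetween p q p₁ d)
    (hw : IsVertexOf w q) : w = p ∨ w = p₁ := by
  obtain ⟨h1, h2, h3, h4⟩ := h
  have hi : ∀ i, i ≠ d → w i = q i := by
    intro i hi
    have := h4 i hi
    have := hw i
    unfold VertexCoord at this
    omega
  have hd := hw d
  unfold VertexCoord at hd
  by_cases hp : w d = p d
  · refine Or.inl (funext fun i => ?_)
    by_cases hid : i = d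
    · rw [hid, hp]
    · rw [hi i hid, (h4 i hid).2.1]
  · refine Or.inr (funext fun i => ?_)
    by_cases hid : i = d
    · subst hid
      omega
    · rw [hi i hid, (h4 i hid).2.2]

theorem IsEdgeBetween.isVertexOf {p q p₁ : Z3} {d : Fin 3} (h : IsEdgeBetween p q p₁ d) :
    IsVertexOf p q ∧ IsVertexOf p₁ q := by
  obtain ⟨h1, h2, h3, h4⟩ := h
  rw [IsVertexOf, IsVertexOf, ← forall_and]
  intro i
  unfold VertexCoord
  by_cases hid : i = d
  · subst hid
    omega
  · have := h4 i hid
    omega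

/-! Points `q + u` near a point `q` representing a cell of the grid. -/

/-- `u` is a direction normal to the cell represented by `q`. -/
def IsNormalSign (q u : Z3) : Prop := IsSign u ∧ ∀ j, 4 ∣ q j → u j = 0

/-- Together with `isNormalSign_sub_base` this makes `x = q + u` a canonical decomposition: `q` is
the rounding of `x`, and `u` the normal displacement. -/
theorem base_add {q u : Z3} (hq : ∀ j, 2 ∣ q j) (hu : IsNormalSign q u) : base (q + u) = q := by
  funext j
  have h1 := hq j
  have h2 := hu.1 j
  have h3 := hu.2 j
  have := baseCoord_spec ((q + u) j)
  simp only [base]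
  simp only [Pi.add_apply] at this ⊢
  omega

theorem isNormalSign_sub_base {x : Z3} : IsNormalSign (base x) (x - base x) := by
  refine ⟨fun j => ?_, fun j => ?_⟩ <;>
  · have := baseCoord_spec (x j)
    simp only [base, Pi.sub_apply]
    omega

theorem touched_add {R : Set Z3} {q u : Z3} (hq : ∀ j, 2 ∣ q j) (hu : IsNormalSign q u) :
    Touched R (q + u) ↔ Touched R q := by
  rw [← touched_base, base_add hq hu]

theorem isVertexOf_add {q u w : Z3} (hq : ∀ j, 2 ∣ q j) (hu : IsNormalSign q u) :
    IsVertexOf w (q + u) ↔ IsVertexOf w q := by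
  rw [← isVertexOf_base, base_add hq hu]

theorem cellDim_add {R : Set Z3} {q u : Z3} (hq : ∀ j, 2 ∣ q j) (hu : IsNormalSign q u)
    (ht : Touched R q) :
    cellDim R (q + u) = (Finset.univ.filter (fun j => u j = 0)).card := by
  rw [cellDim, if_pos ((touched_add hq hu).2 ht)]
  congr 2
  funext j
  have h1 := hq j
  have h2 := hu.1 j
  simp only [Pi.add_apply]
  exact propext (by omega)

theorem add_mem_repairedDom {B R : Set Z3} {q u : Z3} (hq : q ∈ domQ B) (hu : IsNormalSign q u)
    (ht : Touched R q) : q + u ∈ repairedDom B R := by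
  have hq2 := even_of_mem_domQ hq
  exact ⟨by rwa [base_add hq2 hu], Or.inl ((touched_add hq2 hu).2 ht)⟩

theorem mem_N6_iff {u : Z3} : u ∈ N6 1 ↔
    IsSign u ∧ (Finset.univ.filter (fun j => u j = 0)).card = 2 := by
  rw [(card_filter_eq _).2.2.1]
  simp only [N6, Set.mem_ofPred_eq, abs_eq (zero_le_one (α := ℤ))]
  constructor
  · rintro ⟨i, h1, h2⟩
    refine ⟨fun j => ?_, i, by omega, h2⟩
    by_cases hij : j = i
    · subst hij
      omega
    · exact Or.inl (h2 j hij)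
  · rintro ⟨h, i, h1, h2⟩
    exact ⟨i, by have := h i; omega, h2⟩

theorem mem_N12_iff {u : Z3} : u ∈ N12 1 ↔
    IsSign u ∧ (Finset.univ.filter (fun j => u j = 0)).card = 1 := by
  rw [(card_filter_eq _).2.1]
  simp only [N12, Set.mem_ofPred_eq, abs_eq (zero_le_one (α := ℤ))]
  constructor
  · rintro ⟨i, h1, h2⟩
    refine ⟨fun j => ?_, i, by omega, fun j hj => by have := h2 j hj; omega⟩
    by_cases hij : j = i
    · subst hij
      omega
    · exact Or.inr (h2 j hij)
  · rintro ⟨h, i, h1, h2⟩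
    exact ⟨i, h1, fun j hj => (h j).resolve_left (h2 j hj)⟩

theorem mem_N8_iff {u : Z3} : u ∈ N8 1 ↔
    IsSign u ∧ (Finset.univ.filter (fun j => u j = 0)).card = 0 := by
  rw [(card_filter_eq _).1]
  simp only [N8, Set.mem_ofPred_eq, abs_eq (zero_le_one (α := ℤ))]
  constructor
  · intro h
    exact ⟨fun j => Or.inr (h j), fun j => by have := h j; omega⟩
  · rintro ⟨h, h2⟩ j
    exact (h j).resolve_left (h2 j)

theorem mem_around {N : Set Z3} {p u : Z3} : p + u ∈ around N p ↔ u ∈ N := by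
  constructor
  · rintro ⟨q, hq, h⟩
    obtain rfl : u = q := by
      rw [add_comm] at h
      exact add_right_cancel h
    exact hq
  · exact fun h => ⟨u, h, add_comm _ _⟩

theorem exists_of_mem_around {N : Set Z3} {p x : Z3} (h : x ∈ around N p) :
    ∃ u ∈ N, x = p + u := by
  obtain ⟨u, hu, rfl⟩ := h
  exact ⟨u, hu, add_comm _ _⟩

theorem mem_around_NBox {p x : Z3} : x ∈ around (NBox 1) p ↔
    ∃ i, (x i - p i = 1 ∨ x i - p i = -1) ∧ ∀ j, j ≠ i → -1 ≤ x j - p j ∧ x j - p j ≤ 1 := by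
  have : x = p + (x - p) := by abel
  rw [this, mem_around]
  simp only [NBox, Set.mem_ofPred_eq, abs_eq (zero_le_one (α := ℤ)), abs_le, Pi.sub_apply,
    add_sub_cancel]

/-- A step along the edge enters the box around one endpoint, whereas both endpoints stay two units
away if there is none. The deletion in the procedure thus leaves exactly the normal displacements.
-/
theorem IsEdgeBetween.mem_around_iff {p q p₁ u : Z3} {d : Fin 3} (h : IsEdgeBetween p q p₁ d)
    (hu : IsSign u) :
    q + u ∉ around (NBox 1) p ∪ around (NBox 1) p₁ ↔ u d = 0 := by
  obtain ⟨h1, h2, h3, h4⟩ := h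
  have hj : ∀ j, j ≠ d → (-1 ≤ (q + u) j - p j ∧ (q + u) j - p j ≤ 1) ∧
      (-1 ≤ (q + u) j - p₁ j ∧ (q + u) j - p₁ j ≤ 1) := by
    intro j hj
    have := h4 j hj
    have := hu j
    simp only [Pi.add_apply]
    omega
  have hd := hu d
  rw [Set.mem_union, mem_around_NBox, mem_around_NBox]
  constructor
  · intro h
    by_contra hne
    by_cases hp : (q + u) d - p d = 1 ∨ (q + u) d - p d = -1
    · exact h (Or.inl ⟨d, hp, fun j hjd => (hj j hjd).1⟩)
    · refine h (Or.inr ⟨d, ?_, fun j hjd => (hj j hjd).2⟩)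
      simp only [Pi.add_apply] at hp ⊢
      omega
  · intro h0
    rintro (⟨i, hi, hi'⟩ | ⟨i, hi, hi'⟩)
    all_goals
      by_cases hid : i = d
      · subst hid
        simp only [Pi.add_apply] at hi
        omega
      · have := hi' d (Ne.symm hid)
        simp only [Pi.add_apply] at this
        omega

theorem IsEdgeBetween.isNormalSign {p q p₁ u : Z3} {d : Fin 3} (h : IsEdgeBetween p q p₁ d) :
    IsNormalSign q u ↔ IsSign u ∧ u d = 0 := by
  obtain ⟨h1, h2, h3, h4⟩ := h
  refine and_congr_right fun _ => ⟨fun h => h d h1, fun h j hj => ?_⟩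
  by_cases hjd : j = d
  · rw [hjd, h]
  · have := h4 j hjd
    omega

/-- The square represented by `q` is normal to the axis `e`. -/
def IsSquareRep (q : Z3) (e : Fin 3) : Prop := q e % 4 = 2 ∧ ∀ j, j ≠ e → 4 ∣ q j

theorem isSquareRep_of_gQ {B : Set Z3} {q : Z3} (hq : q ∈ domQ B) :
    gQ B q = 2 ↔ ∃ e, IsSquareRep q e := by
  rw [gQ_eq hq]
  have : ((Finset.univ.filter (fun j => (4 : ℤ) ∣ q j)).card : ℤ) = 2 ↔
      ∃ i, ¬ (4 : ℤ) ∣ q i ∧ ∀ j, j ≠ i → (4 : ℤ) ∣ q j := by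
    rw [← (card_filter_eq _).2.2.1]
    norm_cast
  rw [this]
  refine exists_congr fun e => and_congr_left fun _ => ?_
  have := even_of_mem_domQ hq e
  omega

theorem IsSquareRep.isNormalSign {q u : Z3} {e : Fin 3} (h : IsSquareRep q e) :
    IsNormalSign q u ↔ IsSign u ∧ ∀ j, j ≠ e → u j = 0 := by
  refine and_congr_right fun _ => ⟨fun h' j hj => h' j (h.2 j hj), fun h' j hj => ?_⟩
  by_cases hje : j = e
  · subst hje
    have := h.1
    omega
  · exact h' j hje

theorem IsSquareRep.normal_iff {B : Set Z3} {q u : Z3} {e : Fin 3} (h : IsSquareRep q e)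
    (hq : q ∈ domQ B) (hu : u ∈ N6 1) :
    (∀ y ∈ faceReps B q 1, q + u ∉ around (NBox 1) y) ↔ IsNormalSign q u := by
  have hq2 := even_of_mem_domQ hq
  have hs := (mem_N6_iff.1 hu).1
  obtain ⟨i, hi, hi'⟩ := hu
  rw [abs_eq zero_le_one] at hi
  rw [h.isNormalSign]
  constructor
  · intro hy
    refine ⟨hs, fun j hj => ?_⟩
    by_contra hne
    obtain rfl : j = i := by
      by_contra hji
      exact hne (hi' j hji)
    -- This is the edge of the square on the side of `u`; its box contains `q + u` when `u` points
    -- along the square.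
    refine hy (Function.update q j (q j + 2 * u j)) ?_ ?_
    · rw [mem_faceReps hq]
      have h4 := h.2 j hj
      refine ⟨fun k => ?_, fun hk => ?_, ?_⟩
      · rw [gridFaceCoord_even (hq2 k)]
        by_cases hkj : k = j
        · subst hkj
          simp only [Function.update_self]
          omega
        · simp [hkj]
      · have := congrFun hk j
        simp only [Function.update_self] at this
        omega
      · have h2 : (Finset.univ.filter (fun k => (4 : ℤ) ∣ q k)).card = 2 := by
          rw [(card_filter_eq _).2.2.1]
          exact ⟨e, by have := h.1; omega, h.2⟩
        have := card_filter_of_unique (j := j)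
          (P := fun k => (4 : ℤ) ∣ Function.update q j (q j + 2 * u j) k)
          (Q := fun k => (4 : ℤ) ∣ q k) h4 (by simp only [Function.update_self]; omega)
          (fun k hk => by simp [hk])
        omega
    · rw [mem_around_NBox]
      refine ⟨j, ?_, fun k hk => ?_⟩
      · simp only [Function.update_self, Pi.add_apply]
        omega
      · simp [hk, hi' k hk]
  · rintro ⟨-, h0⟩ y hy hx
    rw [mem_faceReps hq] at hy
    obtain ⟨hy, hyq, -⟩ := hy
    have hc : ∀ k, y k = q k ∨ (q k % 4 = 0 ∧ (y k = q k + 2 ∨ y k = q k - 2)) := fun k =>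
      (gridFaceCoord_even (hq2 k)).1 (hy k)
    obtain ⟨k, hk⟩ : ∃ k, y k ≠ q k := by
      by_contra hk
      push Not at hk
      exact hyq (funext hk)
    have hke : k ≠ e := by
      rintro rfl
      have := h.1
      have := hc k
      omega
    have h1 := hc k
    have h2 := h0 k hke
    rw [mem_around_NBox] at hx
    obtain ⟨l, hl, hl'⟩ := hx
    by_cases hkl : k = l
    · subst hkl
      simp only [Pi.add_apply] at hl
      omega
    · have := hl' k hkl
      simp only [Pi.add_apply] at this
      omega

/-! ### The recoloring procedure yields the coordinate formula -/

theorem isNormalSign_zero (q : Z3) : IsNormalSign q 0 :=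
  ⟨fun _ => Or.inl rfl, fun _ _ => rfl⟩

theorem card_zero_sign : (Finset.univ.filter (fun j => (0 : Z3) j = 0)).card = 3 := by
  simp

/-- Several rules may recolor the same point, for instance from both ends of an edge. They agree:
`q` is the rounding of `x`, and the color counts the zeros of `x - q`. -/
theorem Recolored.spec {B : Set Z3} {x : Z3} {k : ℤ} (h : Recolored B x k) :
    ∃ q u, q ∈ domQ B ∧ x = q + u ∧ IsNormalSign q u ∧ Touched (criticalReps B) q ∧
      k = (Finset.univ.filter (fun j => u j = 0)).card := by
  have hvert : ∀ p ∈ criticalReps B, ∀ u, IsSign u →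
      p ∈ domQ B ∧ IsNormalSign p u ∧ Touched (criticalReps B) p := by
    intro p hp u hu
    obtain ⟨h1, h2⟩ := criticalReps_spec hp
    refine ⟨h1, ⟨hu, fun j hj => ?_⟩, p, hp, fun j => ?_⟩
    · have := h2 j
      omega
    · have := h2 j
      unfold VertexCoord
      omega
  cases h with
  | vertex p hp =>
    obtain ⟨h1, h2, h3⟩ := hvert _ hp 0 fun _ => Or.inl rfl
    exact ⟨x, 0, h1, (add_zero _).symm, h2, h3, by rw [card_zero_sign]; rfl⟩
  | vertex2 p hp x hx =>
    obtain ⟨u, hu, rfl⟩ := exists_of_mem_around hx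
    rw [mem_N6_iff] at hu
    obtain ⟨h1, h2, h3⟩ := hvert _ hp u hu.1
    exact ⟨p, u, h1, rfl, h2, h3, by rw [hu.2]; rfl⟩
  | vertex1 p hp x hx =>
    obtain ⟨u, hu, rfl⟩ := exists_of_mem_around hx
    rw [mem_N12_iff] at hu
    obtain ⟨h1, h2, h3⟩ := hvert _ hp u hu.1
    exact ⟨p, u, h1, rfl, h2, h3, by rw [hu.2]; rfl⟩
  | vertex0 p hp x hx =>
    obtain ⟨u, hu, rfl⟩ := exists_of_mem_around hx
    rw [mem_N8_iff] at hu
    obtain ⟨h1, h2, h3⟩ := hvert _ hp u hu.1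
    exact ⟨p, u, h1, rfl, h2, h3, by rw [hu.2]; rfl⟩
  | edge p q p₁ hq =>
    obtain ⟨h1, h2, d, h3⟩ := isCriticalEdge_iff.1 hq
    exact ⟨x, 0, h2, (add_zero _).symm, isNormalSign_zero _, ⟨p, h1, h3.isVertexOf.1⟩,
      by rw [card_zero_sign]; rfl⟩
  | edge2 p q p₁ hq x hx =>
    obtain ⟨h1, h2, d, h3⟩ := isCriticalEdge_iff.1 hq
    obtain ⟨u, hu, rfl⟩ := exists_of_mem_around hx.1
    rw [mem_N6_iff] at hu
    exact ⟨q, u, h2, rfl, h3.isNormalSign.2 ⟨hu.1, (h3.mem_around_iff hu.1).1 hx.2⟩,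
      ⟨p, h1, h3.isVertexOf.1⟩, by rw [hu.2]; rfl⟩
  | edge1 p q p₁ hq x hx =>
    obtain ⟨h1, h2, d, h3⟩ := isCriticalEdge_iff.1 hq
    obtain ⟨u, hu, rfl⟩ := exists_of_mem_around hx.1
    rw [mem_N12_iff] at hu
    exact ⟨q, u, h2, rfl, h3.isNormalSign.2 ⟨hu.1, (h3.mem_around_iff hu.1).1 hx.2⟩,
      ⟨p, h1, h3.isVertexOf.1⟩, by rw [hu.2]; rfl⟩
  | square p hp q hq hd =>
    obtain ⟨h1, h2⟩ := (mem_starReps hp).1 hq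
    exact ⟨x, 0, h1, (add_zero _).symm, isNormalSign_zero _, ⟨p, hp, h2⟩,
      by rw [card_zero_sign]; rfl⟩
  | square2 p hp q hq hd x hx hx' =>
    obtain ⟨h1, h2⟩ := (mem_starReps hp).1 hq
    obtain ⟨e, he⟩ := (isSquareRep_of_gQ h1).1 hd
    obtain ⟨u, hu, rfl⟩ := exists_of_mem_around hx
    refine ⟨q, u, h1, rfl, (he.normal_iff h1 hu).1 hx', ⟨p, hp, h2⟩, ?_⟩
    rw [(mem_N6_iff.1 hu).2]
    rfl

/-- The other vertex of an edge. -/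
theorem exists_isEdgeBetween {p q : Z3} {d : Fin 3} (hd : 4 ∣ q d)
    (hd' : ∀ i, i ≠ d → q i % 4 = 2) (hp : IsVertexOf p q) : ∃ p₁, IsEdgeBetween p q p₁ d := by
  refine ⟨Function.update p d (2 * q d - p d), hd, ?_, by simp, fun i hi => ⟨hd' i hi, ?_, ?_⟩⟩
  · have := hp d
    unfold VertexCoord at this
    omega
  all_goals
    have h1 := hp i
    have h2 := hd' i hi
    unfold VertexCoord at h1
    try rw [Function.update_of_ne hi]
    omega

theorem grid_cases {q : Z3} (hq : ∀ j, 2 ∣ q j) :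
    (∀ j, q j % 4 = 2) ∨ (∃ d, 4 ∣ q d ∧ ∀ i, i ≠ d → q i % 4 = 2) ∨
      (∃ e, IsSquareRep q e) ∨ ∀ j, 4 ∣ q j := by
  have h0 := hq 0
  have h1 := hq 1
  have h2 := hq 2
  unfold IsSquareRep
  rw [exists_fin_three, exists_fin_three]
  simp only [Fin.forall_fin_succ, Fin.isValue, Fin.succ_zero_eq_one,
    Fin.succ_one_eq_two, IsEmpty.forall_iff, and_true]
  omega

theorem eq_of_isVertexOf {p q : Z3} (hq : ∀ j, q j % 4 = 2) (h : IsVertexOf p q) : p = q := by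
  funext j
  have h1 := h j
  have h2 := hq j
  unfold VertexCoord at h1
  omega

theorem sign_cases {u : Z3} (hu : IsSign u) : u = 0 ∨ u ∈ N6 1 ∨ u ∈ N12 1 ∨ u ∈ N8 1 := by
  have hle : (Finset.univ.filter (fun j => u j = 0)).card ≤ 3 := Finset.card_filter_le _ _
  have h3 : (Finset.univ.filter (fun j => u j = 0)).card = 3 → u = 0 := fun h =>
    funext ((card_filter_eq _).2.2.2.1 h)
  rw [mem_N6_iff, mem_N12_iff, mem_N8_iff]
  by_cases h : (Finset.univ.filter (fun j => u j = 0)).card = 3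
  · exact Or.inl (h3 h)
  · simp only [hu, true_and]
    omega

/-- The procedure has no rule for cubes; this is the second alternative. -/
theorem exists_recolored {B : Set Z3} {q u : Z3} (hq : q ∈ domQ B) (hu : IsNormalSign q u)
    (ht : Touched (criticalReps B) q) : (∃ k, Recolored B (q + u) k) ∨ ∀ j, 4 ∣ q j := by
  have hq2 := even_of_mem_domQ hq
  obtain ⟨p, hp, hpq⟩ := ht
  have hst : q ∈ starReps B p := (mem_starReps hp).2 ⟨hq, hpq⟩
  rcases grid_cases hq2 with h | ⟨d, h, h'⟩ | ⟨e, h⟩ | h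
  · obtain rfl := eq_of_isVertexOf h hpq
    rcases sign_cases hu.1 with rfl | hN | hN | hN
    · exact Or.inl ⟨3, by rw [add_zero]; exact .vertex p hp⟩
    · exact Or.inl ⟨2, .vertex2 p hp _ (mem_around.2 hN)⟩
    · exact Or.inl ⟨1, .vertex1 p hp _ (mem_around.2 hN)⟩
    · exact Or.inl ⟨0, .vertex0 p hp _ (mem_around.2 hN)⟩
  · obtain ⟨p₁, he⟩ := exists_isEdgeBetween h h' hpq
    have hc : IsCriticalEdge B p q p₁ := isCriticalEdge_iff.2 ⟨hp, hq, d, he⟩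
    have hud := (he.isNormalSign.1 hu).2
    have hnot := (he.mem_around_iff hu.1).2 hud
    rcases sign_cases hu.1 with rfl | hN | hN | hN
    · exact Or.inl ⟨3, by rw [add_zero]; exact .edge p q p₁ hc⟩
    · exact Or.inl ⟨2, .edge2 p q p₁ hc _ ⟨mem_around.2 hN, hnot⟩⟩
    · exact Or.inl ⟨1, .edge1 p q p₁ hc _ ⟨mem_around.2 hN, hnot⟩⟩
    · have := (card_filter_eq _).1.1 (mem_N8_iff.1 hN).2 d
      exact absurd hud this
  · have hd := (isSquareRep_of_gQ hq).2 ⟨e, h⟩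
    by_cases hu0 : u = 0
    · subst hu0
      exact Or.inl ⟨3, by rw [add_zero]; exact .square p hp q hst hd⟩
    · have hN : u ∈ N6 1 := by
        have h0 := (h.isNormalSign.1 hu).2
        rw [mem_N6_iff, (card_filter_eq _).2.2.1]
        refine ⟨hu.1, e, fun hue => hu0 (funext fun j => ?_), h0⟩
        by_cases hje : j = e
        · rw [hje, hue]
          rfl
        · exact h0 j hje
      exact Or.inl ⟨2, .square2 p hp q hst hd _ (mem_around.2 hN) ((h.normal_iff hq hN).2 hu)⟩
  · exact Or.inr h

theorem gP_eq (B : Set Z3) (x : Z3) : gP B x = repairedColor B (criticalReps B) x := by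
  unfold gP
  split_ifs with h
  · obtain ⟨q, u, hq, hx, hu, ht, hk⟩ := h.choose_spec.spec
    have hmem := add_mem_repairedDom hq hu ht
    rw [← hx] at hmem
    rw [hk, repairedColor, if_pos hmem]
    have := cellDim_add (even_of_mem_domQ hq) hu ht
    rw [← hx] at this
    rw [this]
  · by_cases hx : x ∈ repairedDom B (criticalReps B)
    · rw [repairedColor, if_pos hx]
      by_cases ht : Touched (criticalReps B) x
      · have h1 := exists_recolored hx.1 isNormalSign_sub_base (touched_base.2 ht)
        rw [add_sub_cancel] at h1
        have h4 := h1.resolve_left h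
        -- A touched point left unchanged is the centre of a cube, where the old color is three and
        -- so is the number of even coordinates.
        have h5 : x = base x := by
          have h6 := (isNormalSign_sub_base (x := x)).2
          funext j
          have := h6 j (h4 j)
          simp only [Pi.sub_apply] at this
          omega
        have hxd := hx.1
        rw [← h5] at hxd h4
        rw [gQ_eq hxd, cellDim, if_pos ht, (card_filter_eq _).2.2.2.2 h4,
          (card_filter_eq _).2.2.2.2 (even_of_mem_domQ hxd)]
      · have hx2 := hx.2.resolve_left ht
        have hxd := hx.1
        rw [base_of_even hx2] at hxd
        rw [gQ_eq hxd, cellDim, if_neg ht]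
    · rw [repairedColor, if_neg hx, gQ, if_neg]
      intro hxd
      exact hx ⟨by rwa [base_of_mem_domQ hxd], Or.inr (even_of_mem_domQ hxd)⟩

theorem domP_eq (B : Set Z3) : domP B = repairedDom B (criticalReps B) := by
  ext x
  simp only [domP, Set.mem_ofPred_eq, gP_eq, repairedColor]
  split_ifs with h
  · simp only [h, iff_true]
    omega
  · simp [h]

/-! ### The polyhedra of the procedure as repaired cells -/

/-- If every vertex of the grid cell is repaired, only odd vertices remain and they form a box. This
serves both `c(v)` and the cube on an edge with two critical ends. -/
theorem boxFace_eq_repairedCell {B R : Set Z3} {q s : Z3} (hq : q ∈ domQ B)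
    (hs : IsNormalSign q s) (ht : Touched R q) (hR : ∀ w, IsVertexOf w q → w ∈ R) :
    boxFace q 1 s = repairedCell R (q + s) := by
  have hq2 := even_of_mem_domQ hq
  rw [boxFace, repairedCell, cellDim_add hq2 hs ht, cellOf_inj]
  refine ⟨rfl, Set.ext fun y => ⟨?_, ?_⟩⟩
  · rintro ⟨e, he, hes, rfl⟩
    have hy : ∀ j, (q + (1 : ℤ) • e) j % 2 = 1 ∧ (q + s) j - 1 ≤ (q + (1 : ℤ) • e) j ∧
        (q + (1 : ℤ) • e) j ≤ (q + s) j + 1 := by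
      intro j
      have h1 := hq2 j
      have h2 := he j
      have h3 := hes j
      have h4 := hs.1 j
      simp only [Pi.add_apply, Pi.smul_apply, smul_eq_mul]
      omega
    exact Or.inr ⟨hy, hR _ ((isVertexOf_add hq2 hs).1 (isVertexOf_of_odd hy))⟩
  · rintro (h | h)
    · exact absurd (hR y ((isVertexOf_add hq2 hs).1 h.2)) h.1
    · have h1 := h.1
      refine ⟨y - q, fun j => ?_, fun j hj => ?_, by rw [one_smul, add_sub_cancel]⟩ <;>
      · have h1 := h1 j
        have h2 := hq2 j
        have h4 := hs.1 j
        simp only [Pi.add_apply, Pi.sub_apply] at *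
        omega

theorem IsEdgeBetween.direction {p q p₁ c : Z3} {d : Fin 3} (h : IsEdgeBetween p q p₁ d)
    (hc : q = p + (2 : ℤ) • c) :
    (∀ j, q j = p j + 2 * c j) ∧ c d ≠ 0 ∧ ∀ i, i ≠ d → c i = 0 := by
  have hcj : ∀ j, q j = p j + 2 * c j := by
    intro j
    have := congrFun hc j
    simpa only [Pi.add_apply, Pi.smul_apply, smul_eq_mul] using this
  obtain ⟨h1, h2, h3, h4⟩ := h
  refine ⟨hcj, ?_, fun i hi => ?_⟩
  · have := hcj d
    omega
  · have := hcj i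
    have := h4 i hi
    omega

theorem IsEdgeBetween.isNormalSign_sub {p q p₁ s c : Z3} {d : Fin 3}
    (h : IsEdgeBetween p q p₁ d) (hs : IsSign s) (hc : q = p + (2 : ℤ) • c)
    (hcs : ∀ j, c j ≠ 0 → s j = c j) : IsNormalSign q (s - c) := by
  obtain ⟨-, hcd⟩ := h.direction hc
  rw [h.isNormalSign]
  refine ⟨fun j => ?_, ?_⟩
  · by_cases hj : j = d
    · subst hj
      have := hcs j hcd.1
      simp only [Pi.sub_apply]
      omega
    · have h1 := hcd.2 j hj
      have h2 := hs j
      simp only [Pi.sub_apply]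
      omega
  · have := hcs d hcd.1
    simp only [Pi.sub_apply]
    omega

/-- The apex is the only kept vertex, and the odd vertices are those rounding to the critical end,
which are the vertices of the base. -/
theorem cone_eq_repairedCell {B R : Set Z3} {p q p₁ : Z3} {d : Fin 3} (hq : q ∈ domQ B)
    (h : IsEdgeBetween p q p₁ d) (hp : p ∈ R) (hp₁ : p₁ ∉ R) {s : Z3} (hs : IsSign s)
    {c : Z3} (hc : q = p + (2 : ℤ) • c) (hcs : ∀ j, c j ≠ 0 → s j = c j) :
    cone p₁ (boxFace p 1 s) = repairedCell R (q + (s - c)) := by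
  have hq2 := even_of_mem_domQ hq
  obtain ⟨hp2, hp₁2⟩ := h.isVertexOf
  obtain ⟨hcj, hcd⟩ := h.direction hc
  have hu := h.isNormalSign_sub hs hc hcs
  have ht : Touched R q := ⟨p, hp, hp2⟩
  have hpj : ∀ j, p j % 4 = 2 := fun j => (hp2 j).1
  have hverts : insert p₁ {x | ∃ e, IsCorner e ∧ (∀ j, s j ≠ 0 → e j = s j) ∧
      x = p + (1 : ℤ) • e} = cellVerts R (q + (s - c)) := by
    ext y
    constructor
    · rintro (rfl | ⟨e, he, hes, rfl⟩)
      · exact Or.inl ⟨hp₁, (isVertexOf_add hq2 hu).2 hp₁2⟩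
      · refine Or.inr ⟨fun j => ?_, ?_⟩
        · have h1 := hpj j
          have h2 := hcj j
          have h3 := hes j
          have h4 := hs j
          have h5 := he j
          have h6 := hcs j
          simp only [Pi.add_apply, Pi.sub_apply, Pi.smul_apply, smul_eq_mul]
          omega
        · convert hp
          funext j
          have h1 := hpj j
          have h2 := baseCoord_spec ((p + (1 : ℤ) • e) j)
          have h3 := he j
          simp only [base]
          simp only [Pi.add_apply, Pi.smul_apply, smul_eq_mul] at h2 ⊢
          omega
    · rintro (hy | hy)
      · rcases h.eq_or_eq ((isVertexOf_add hq2 hu).1 hy.2) with rfl | rfl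
        · exact absurd hp hy.1
        · exact Or.inl rfl
      · have hb : base y = p := by
          rcases h.eq_or_eq ((isVertexOf_add hq2 hu).1 (isVertexOf_of_odd hy.1)) with hb | hb
          · exact hb
          · exact absurd (hb ▸ hy.2) hp₁
        refine Or.inr ⟨y - p, fun j => ?_, fun j hj => ?_, by rw [one_smul, add_sub_cancel]⟩ <;>
        · have h1 := hy.1 j
          have h2 := congrFun hb j
          have h3 := baseCoord_spec (y j)
          have h4 := hcs j
          have h5 := hs j
          have h6 := hcj j
          simp only [base, Pi.add_apply, Pi.sub_apply] at *
          omega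
  have hdim : (Finset.univ.filter (fun j => s j = 0)).card + 1 = cellDim R (q + (s - c)) := by
    rw [cellDim_add hq2 hu ht]
    -- Along the edge `s` agrees with `c`, so `s - c` has exactly one zero more than `s`: the extra
    -- dimension of the cone.
    refine card_filter_of_unique (j := d) ?_ ?_ fun i hi => ?_
    · have := hcs d hcd.1
      simp only [Pi.sub_apply]
      omega
    · have := hcs d hcd.1
      omega
    · simp [hcd.2 i hi]
  rw [repairedCell, ← hverts, ← hdim]
  simp only [cone, boxFace, cellOf, Set.image_insert_eq]

/-- For a vertex `q + 2 • e`, the entries of `e` are odd on the free axes and zero on the normal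
ones, where `n` is nonzero by `hn'`. So `q + e + n` is odd throughout and rounds back to the vertex.
A free axis ensures that vertices are proper faces. -/
theorem movedVerts_eq {B : Set Z3} {q n : Z3} (hq : q ∈ domQ B) (hn : IsNormalSign q n)
    (hn' : ∀ j, ¬ 4 ∣ q j → n j ≠ 0) (hfree : ∃ j, 4 ∣ q j) :
    movedVerts B q n = cellVerts (criticalReps B) (q + n) := by
  have hq2 := even_of_mem_domQ hq
  have hface : ∀ w, w ∈ faceReps B q 0 ↔ IsVertexOf w q := by
    intro w
    rw [mem_faceReps_zero hq, and_iff_left_iff_imp]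
    rintro h rfl
    obtain ⟨j, hj⟩ := hfree
    have := (h j).1
    omega
  ext y
  simp only [movedVerts, hface, Set.mem_ofPred_eq]
  constructor
  · rintro ⟨e, he, hy⟩
    split_ifs at hy with hc
    · have hj : ∀ j, y j = q j + e j + n j := fun j => by rw [hy]; rfl
      have hoc : ∀ j, base y j = (q + (2 : ℤ) • e) j ∧
          y j % 2 = 1 ∧ (q + n) j - 1 ≤ y j ∧ y j ≤ (q + n) j + 1 := by
        intro j
        have h1 := hj j
        have h2 := he j
        have h3 := hn.1 j
        have h4 := hn.2 j
        have h5 := hn' j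
        have h6 := hq2 j
        have h7 := baseCoord_spec (y j)
        unfold VertexCoord at h2
        simp only [base, Pi.add_apply, Pi.smul_apply, smul_eq_mul] at *
        omega
      refine Or.inr ⟨fun j => (hoc j).2, ?_⟩
      rwa [show base y = q + (2 : ℤ) • e from funext fun j => (hoc j).1]
    · rw [hy]
      exact Or.inl ⟨hc, (isVertexOf_add hq2 hn).2 he⟩
  · rintro (hy | hy)
    · have h0 := (isVertexOf_add hq2 hn).1 hy.2
      have h1 : q + (2 : ℤ) • (fun j => (y j - q j) / 2 : Z3) = y := by
        funext j
        have h2 := h0 j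
        have h3 := hq2 j
        unfold VertexCoord at h2
        simp only [Pi.add_apply, Pi.smul_apply, smul_eq_mul]
        omega
      refine ⟨_, h1.symm ▸ h0, ?_⟩
      rw [h1, if_neg hy.1]
    · have h1 : q + (2 : ℤ) • (y - q - n) = base y := by
        funext j
        have h2 := hy.1 j
        have h3 := hn.1 j
        have h4 := hn.2 j
        have h5 := hn' j
        have h6 := hq2 j
        have h7 := baseCoord_spec (y j)
        simp only [base, Pi.add_apply, Pi.sub_apply, Pi.smul_apply, smul_eq_mul] at *
        omega
      refine ⟨y - q - n, ?_, ?_⟩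
      · rw [h1]
        exact (isVertexOf_add hq2 hn).1 (isVertexOf_of_odd hy.1)
      · rw [h1, if_pos hy.2]
        abel

theorem IsSquareRep.isNormal {q n : Z3} {e : Fin 3} (h : IsSquareRep q e) (hn : IsNormal q n) :
    IsNormalSign q n ∧ ∀ j, ¬ 4 ∣ q j → n j ≠ 0 := by
  have h1 := mem_N6_iff.1 hn.1
  have hns : IsNormalSign q n := ⟨h1.1, fun j hj => by
    by_contra h0
    exact hn.2 j h0 hj⟩
  refine ⟨hns, fun j hj h0 => ?_⟩
  obtain ⟨i, hi, -⟩ := (card_filter_eq _).2.2.1.1 h1.2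
  obtain rfl : j = e := by
    by_contra hje
    exact hj (h.2 j hje)
  obtain rfl : i = j := by
    by_contra hij
    exact hi ((h.isNormalSign.1 hns).2 i hij)
  exact hi h0

theorem IsSquareRep.quad_eq {B : Set Z3} {q n : Z3} {e : Fin 3} (h : IsSquareRep q e)
    (hq : q ∈ domQ B) (ht : Touched (criticalReps B) q) (hn : IsNormal q n) :
    quad B q n = repairedCell (criticalReps B) (q + n) := by
  obtain ⟨h1, h2⟩ := h.isNormal hn
  obtain ⟨j, hj⟩ := exists_ne e
  rw [quad, movedVerts_eq hq h1 h2 ⟨j, h.2 j hj⟩, repairedCell,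
    cellDim_add (even_of_mem_domQ hq) h1 ht, (mem_N6_iff.1 hn.1).2]

theorem IsNormal.neg {q n : Z3} (hn : IsNormal q n) : IsNormal q (-n) := by
  refine ⟨?_, fun j hj => hn.2 j (by simpa using hj)⟩
  have := hn.1
  simpa [N6] using this

/-- Kept vertices belong to both quadrilaterals, and each odd vertex lies on exactly one side along
the normal axis. -/
theorem IsSquareRep.slab_eq {B : Set Z3} {q n : Z3} {e : Fin 3} (h : IsSquareRep q e)
    (hq : q ∈ domQ B) (ht : Touched (criticalReps B) q) (hn : IsNormal q n) :
    slab B q n = repairedCell (criticalReps B) q := by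
  have hq2 := even_of_mem_domQ hq
  obtain ⟨h1, h2⟩ := h.isNormal hn
  obtain ⟨h3, h4⟩ := h.isNormal hn.neg
  obtain ⟨j, hj⟩ := exists_ne e
  have hd := cellDim_add hq2 (isNormalSign_zero q) ht
  rw [card_zero_sign, add_zero] at hd
  rw [slab, movedVerts_eq hq h1 h2 ⟨j, h.2 j hj⟩, movedVerts_eq hq h3 h4 ⟨j, h.2 j hj⟩,
    repairedCell, hd, cellOf_inj]
  refine ⟨rfl, Set.Subset.antisymm (Set.union_subset ?_ ?_) ?_⟩
  · refine subset_of_touchedFaceCoord fun j => ?_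
    have := h1.1 j
    have := hq2 j
    unfold TouchedFaceCoord
    simp only [Pi.add_apply]
    omega
  · refine subset_of_touchedFaceCoord fun j => ?_
    have := h3.1 j
    have := hq2 j
    unfold TouchedFaceCoord
    simp only [Pi.add_apply]
    omega
  · rintro y (hy | hy)
    · exact Or.inl (Or.inl ⟨hy.1, (isVertexOf_add hq2 h1).2 hy.2⟩)
    · have key : ∀ m, IsNormalSign q m → (∀ j, ¬ 4 ∣ q j → m j ≠ 0) → y e = q e + m e →
          y ∈ cellVerts (criticalReps B) (q + m) := by
        intro m hm hm' hye
        refine Or.inr ⟨fun j => ?_, hy.2⟩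
        have h5 := hy.1 j
        by_cases hje : j = e
        · subst hje
          simp only [Pi.add_apply]
          omega
        · have := hm.2 j (h.2 j hje)
          simp only [Pi.add_apply]
          omega
      have h5 := hy.1 e
      have h6 := h.1
      have h7 := h1.1 e
      have h8 := h2 e (by omega)
      by_cases hs : y e = q e + n e
      · exact Or.inl (key n h1 h2 hs)
      · refine Or.inr (key (-n) h3 h4 ?_)
        simp only [Pi.neg_apply]
        omega

theorem hexahedron_eq {B : Set Z3} {q : Z3} (hq : q ∈ domQ B)
    (ht : Touched (criticalReps B) q) (h : ∀ j, 4 ∣ q j) :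
    hexahedron B q = repairedCell (criticalReps B) q := by
  have hd := cellDim_add (even_of_mem_domQ hq) (isNormalSign_zero q) ht
  rw [card_zero_sign, add_zero] at hd
  rw [hexahedron, movedVerts_eq hq (isNormalSign_zero q) (fun j hj => absurd (h j) hj) ⟨0, h 0⟩,
    repairedCell, hd, add_zero]

theorem gQ_eq_three {B : Set Z3} {q : Z3} (hq : q ∈ domQ B) : gQ B q = 3 ↔ ∀ j, 4 ∣ q j := by
  rw [gQ_eq hq, ← (card_filter_eq _).2.2.2]
  norm_cast

/-! ### The correspondence and the complex `P(I)` -/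

/-- Each point represents at most one cell, so the choice in `hP` is harmless. -/
theorem Represents.spec {B : Set Z3} {x : Z3} {σ : Cell 3} (h : Represents B x σ) :
    x ∈ repairedDom B (criticalReps B) ∧ σ = repairedCell (criticalReps B) x := by
  cases h with
  | kept x hx h =>
    have hx2 := even_of_mem_domQ hx
    refine ⟨⟨by rwa [base_of_mem_domQ hx], Or.inr hx2⟩, hQ_eq_repairedCell hx2 ?_⟩
    rintro ⟨v, hv, hvx⟩
    exact h v hv ((mem_starReps hv).2 ⟨hx, hvx⟩)
  | vertexCube p hp s hs =>
    obtain ⟨h1, h2⟩ := criticalReps_spec hp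
    have hn : IsNormalSign p s := ⟨hs, fun j hj => by have := h2 j; omega⟩
    have hpp : IsVertexOf p p := fun j => by
      have := h2 j
      unfold VertexCoord
      omega
    have ht : Touched (criticalReps B) p := ⟨p, hp, hpp⟩
    refine ⟨add_mem_repairedDom h1 hn ht, boxFace_eq_repairedCell h1 hn ht fun w hw => ?_⟩
    rwa [eq_of_isVertexOf h2 hw]
  | pyramid p q p₁ hq h₁ c s hd hs hds =>
    obtain ⟨hp, hqd, d, he⟩ := isCriticalEdge_iff.1 hq
    have hcone := cone_eq_repairedCell hqd he hp h₁ hs hd hds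
    exact ⟨add_mem_repairedDom hqd (he.isNormalSign_sub hs hd hds) ⟨p, hp, he.isVertexOf.1⟩,
      hcone⟩
  | edgeCube p q p₁ hq h₁ c s hd hs hds =>
    obtain ⟨hp, hqd, d, he⟩ := isCriticalEdge_iff.1 hq
    have ht : Touched (criticalReps B) q := ⟨p, hp, he.isVertexOf.1⟩
    have hn : IsNormalSign q s := by
      refine he.isNormalSign.2 ⟨hs, hds d fun h0 => ?_⟩
      have := congrFun hd d
      have := he.2.1
      simp only [Pi.add_apply, Pi.smul_apply, smul_eq_mul] at *
      omega
    refine ⟨add_mem_repairedDom hqd hn ht, boxFace_eq_repairedCell hqd hn ht fun w hw => ?_⟩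
    rcases he.eq_or_eq hw with rfl | rfl
    · exact hp
    · exact h₁
  | square p hp q hq hd n hn =>
    obtain ⟨h1, h2⟩ := (mem_starReps hp).1 hq
    obtain ⟨e, he⟩ := (isSquareRep_of_gQ h1).1 hd
    have ht : Touched (criticalReps B) x := ⟨p, hp, h2⟩
    exact ⟨⟨by rwa [base_of_mem_domQ h1], Or.inl ht⟩, he.slab_eq h1 ht hn⟩
  | squareFace p hp q hq hd n hn =>
    obtain ⟨h1, h2⟩ := (mem_starReps hp).1 hq
    obtain ⟨e, he⟩ := (isSquareRep_of_gQ h1).1 hd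
    have ht : Touched (criticalReps B) q := ⟨p, hp, h2⟩
    exact ⟨add_mem_repairedDom h1 (he.isNormal hn).1 ht, he.quad_eq h1 ht hn⟩
  | cube p hp q hq hd =>
    obtain ⟨h1, h2⟩ := (mem_starReps hp).1 hq
    have ht : Touched (criticalReps B) x := ⟨p, hp, h2⟩
    exact ⟨⟨by rwa [base_of_mem_domQ h1], Or.inl ht⟩, hexahedron_eq h1 ht ((gQ_eq_three h1).1 hd)⟩

theorem exists_represents_of_touched {B : Set Z3} {q u : Z3} (hq : q ∈ domQ B)
    (hu : IsNormalSign q u) (ht : Touched (criticalReps B) q) : ∃ σ, Represents B (q + u) σ := by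
  have hq2 := even_of_mem_domQ hq
  obtain ⟨p, hp, hpq⟩ := ht
  have hst : q ∈ starReps B p := (mem_starReps hp).2 ⟨hq, hpq⟩
  rcases grid_cases hq2 with h | ⟨d, h, h'⟩ | ⟨e, h⟩ | h
  · obtain rfl := eq_of_isVertexOf h hpq
    exact ⟨_, .vertexCube p hp u hu.1⟩
  · obtain ⟨p₁, he⟩ := exists_isEdgeBetween h h' hpq
    have hc : IsCriticalEdge B p q p₁ := isCriticalEdge_iff.2 ⟨hp, hq, d, he⟩
    have hud := (he.isNormalSign.1 hu).2
    set c : Z3 := fun j => (q j - p j) / 2 with hcdef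
    have hcd : ∀ i, i ≠ d → c i = 0 := by
      intro i hi
      have := he.2.2.2 i hi
      simp only [hcdef]
      omega
    have hcd' : c d = 1 ∨ c d = -1 := by
      have := he.2.1
      simp only [hcdef]
      omega
    have hqc : q = p + (2 : ℤ) • c := by
      funext j
      simp only [Pi.add_apply, Pi.smul_apply, smul_eq_mul]
      by_cases hj : j = d
      · subst hj
        have := he.2.1
        simp only [hcdef]
        omega
      · have := he.2.2.2 j hj
        have := hcd j hj
        omega
    have hcj : ∀ j, c j ≠ 0 → j = d := fun j hj => by
      by_contra hjd
      exact hj (hcd j hjd)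
    by_cases h₁ : p₁ ∈ criticalReps B
    · refine ⟨_, .edgeCube p q p₁ hc h₁ c u hqc hu.1 fun j hj => ?_⟩
      rw [hcj j hj, hud]
    -- The face of `c(v)` has the edge direction `c` added to the normal displacement `u`;
    -- subtracting `c` again returns the point `q + u`.
    · have := Represents.pyramid p q p₁ hc h₁ c (u + c) hqc (fun j => ?_) fun j hj => ?_
      · rw [add_sub_cancel_right] at this
        exact ⟨_, this⟩
      · by_cases hjd : j = d
        · subst hjd
          simp only [Pi.add_apply, hud]
          omega
        · simpa only [Pi.add_apply, hcd j hjd, add_zero] using hu.1 j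
      · rw [hcj j hj, Pi.add_apply, hud, zero_add]
  · have hd := (isSquareRep_of_gQ hq).2 ⟨e, h⟩
    have hN : ∀ u : Z3, (u e = 1 ∨ u e = -1) → (∀ j, j ≠ e → u j = 0) → IsNormal q u := by
      intro u hue h0
      refine ⟨⟨e, by rwa [abs_eq zero_le_one], h0⟩, fun j hj => ?_⟩
      obtain rfl : j = e := by
        by_contra hje
        exact hj (h0 j hje)
      have := h.1
      omega
    obtain ⟨hus, hu0⟩ := h.isNormalSign.1 hu
    rcases hus e with h0 | h0
    · have : u = 0 := by
        funext j
        by_cases hje : j = e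
        · rw [hje, h0]
          rfl
        · exact hu0 j hje
      rw [this, add_zero]
      -- Either unit normal would do, as the polyhedron is the union over both sides.
      exact ⟨_, .square p hp q hst hd (Pi.single e 1) (hN _ (by simp) fun j hj => by simp [hj])⟩
    · exact ⟨_, .squareFace p hp q hst hd u (hN u h0 hu0)⟩
  · have : u = 0 := funext fun j => hu.2 j (h j)
    rw [this, add_zero]
    exact ⟨_, .cube p hp q hst ((gQ_eq_three hq).2 h)⟩

theorem exists_represents {B : Set Z3} {x : Z3} (hx : x ∈ repairedDom B (criticalReps B)) :
    ∃ σ, Represents B x σ := by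
  by_cases ht : Touched (criticalReps B) x
  · have := exists_represents_of_touched hx.1 isNormalSign_sub_base (touched_base.2 ht)
    rwa [add_sub_cancel] at this
  · have hxd := hx.1
    rw [base_of_even (hx.2.resolve_left ht)] at hxd
    exact ⟨_, .kept x hxd fun p hp h => ht ⟨p, hp, ((mem_starReps hp).1 h).2⟩⟩

theorem hP_eq {B : Set Z3} {x : Z3} (hx : x ∈ repairedDom B (criticalReps B)) :
    hP B x = repairedCell (criticalReps B) x := by
  have h := exists_represents hx
  rw [hP, dif_pos h]
  exact h.choose_spec.spec.2

/-- The constructors of the two relations correspond one to one, `Represents` merely recording the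
point as well. -/
theorem isRepairedCell_iff {B : Set Z3} {σ : Cell 3} :
    IsRepairedCell B σ ↔ ∃ x, Represents B x σ := by
  constructor
  · intro h
    cases h with
    | kept σ hσ h =>
      have hσ' := hσ
      rw [cubicalComplex_eq] at hσ'
      obtain ⟨x, hx, rfl⟩ := hσ'
      exact ⟨x, .kept x hx fun p hp h' => h p hp h'.2⟩
    | vertexCube p hp s hs => exact ⟨_, .vertexCube p hp s hs⟩
    | pyramid p q p₁ hq h₁ d s hd hs hds => exact ⟨_, .pyramid p q p₁ hq h₁ d s hd hs hds⟩
    | edgeCube p q p₁ hq h₁ d s hd hs hds => exact ⟨_, .edgeCube p q p₁ hq h₁ d s hd hs hds⟩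
    | square p hp q hq hd n hn => exact ⟨_, .square p hp q hq hd n hn⟩
    | squareFace p hp q hq hd n hn => exact ⟨_, .squareFace p hp q hq hd n hn⟩
    | cube p hp q hq hd => exact ⟨_, .cube p hp q hq hd⟩
  · rintro ⟨x, h⟩
    cases h with
    | kept x hx h =>
      refine .kept _ ?_ fun p hp h' => h p hp ⟨hx, h'⟩
      rw [cubicalComplex_eq]
      exact ⟨x, hx, rfl⟩
    | vertexCube p hp s hs => exact .vertexCube p hp s hs
    | pyramid p q p₁ hq h₁ d s hd hs hds => exact .pyramid p q p₁ hq h₁ d s hd hs hds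
    | edgeCube p q p₁ hq h₁ d s hd hs hds => exact .edgeCube p q p₁ hq h₁ d s hd hs hds
    | square p hp q hq hd n hn => exact .square p hp _ hq hd n hn
    | squareFace p hp q hq hd n hn => exact .squareFace p hp q hq hd n hn
    | cube p hp q hq hd => exact .cube p hp _ hq hd

theorem polyhedralComplex_eq (B : Set Z3) :
    polyhedralComplex B = repairedCell (criticalReps B) '' repairedDom B (criticalReps B) := by
  ext σ
  constructor
  · intro h
    obtain ⟨x, hx⟩ := isRepairedCell_iff.1 h
    exact ⟨x, hx.spec.1, hx.spec.2.symm⟩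
  · rintro ⟨x, hx, rfl⟩
    obtain ⟨σ, hσ⟩ := exists_represents hx
    rw [← hσ.spec.2]
    exact isRepairedCell_iff.2 ⟨x, hσ⟩

end ECM

theorem mainTheorem2 (B : Set (Fin 3 → ℤ)) :
    ECM.IsECMRepresentation (ECM.polyhedralComplex B) (ECM.domP B) (ECM.hP B) (ECM.gP B)
      ECM.structuringElementsP := by
  rw [ECM.polyhedralComplex_eq, ECM.domP_eq, show ECM.gP B = _ from funext (ECM.gP_eq B)]
  exact ECM.isECMRepresentation_repaired fun x hx => ECM.hP_eq hx
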